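/- Let $G$ be a group and $S\subset G$ a finite symmetric generating set. In the group ring $\mathbb R[G]$ with involution $(\sum_g r_g g)^*=\sum_g r_g g^{-1}$ put $\Delta=|S|-\sum_{s\in S}s$. A number $\varepsilon>0$ is a spectral gap if $\Delta^2-\varepsilon\Delta=\sum_{i=1}^n b_i^*b_i$ for some $b_1,\dots,b_n\in\mathbb R[G]$; the spectral gap $\varepsilon(G,S)\in[0,\infty]$ is the supremum of all such $\varepsilon$ (and $0$ if there are none). The Kazhdan constant is $\kappa(G,S)=\inf_\pi\inf_{\|\xi\|=1}\max_{s\in S}\|\pi(s)\xi-\xi\|$, where $\pi$ runs over the unitary representations of $G$ on Hilbert spaces without non-zero invariant vectors. Consider Ronan's four groups $$\begin{aligned} G_1&=\langle a,b,c\mid a^3,b^3,c^3,(ab)^2=ba,(bc)^2=cb,(ca)^2=ac\rangle,\\ G_2&=\langle a,b,c\mid a^3,b^3,c^3,(ab)^2=ba,(bc)^2=cb,(ac)^2=ca\rangle,\\ G_3&=\langle a,b,c\mid a^3,b^3,c^3,(ab)^2=ba,(ac)^2=ca,(c^{-1}b)^2=bc^{-1}\rangle,\\ G_4&=\langle a,b,c\mid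 a^3,b^3,c^3,(ab)^2=ba,(ac)^2=ca,(bc^{-1})^2=c^{-1}b\rangle. \end{aligned}$$ **Theorem.** (1) For $i=1,2,3,4$ and $S=\{a^{\pm1},b^{\pm1},c^{\pm1}\}\subset G_i$, $$\sqrt{2\,\varepsilon(G_i,S)/6}\ \ge\ 0.238\qquad\text{and}\qquad \kappa(G_i,S)\ \ge\ 0.238 .$$ (2) Let $X$ be a trivalent triangle geometry: a non-empty connected 2-dimensional complex of triangles, whose vertices have three types such that each triangle has one vertex of each type, and such that the link of each vertex is the incidence graph of the projective plane $PG(2,2)$. Let a group $G$ act on $X$ by type-preserving automorphisms, regularly (simply transitively) on the set of triangles, and fix a triangle $t$. Then the stabilizers in $G$ of the three sides of $t$ are cyclic. Moreover $G$ is a quotient of some $G_i$, by a surjection $G_i\to G$ that maps $a,b,c$, in some order, to generators of the stabilizers of the three sides of $t$. If $x,y,z\in G$ are any generators of these three stabilizers ("natural generators"), then $x,y,z$ generate $G$, and for $S=\{x^{\pm1},y^{\pm1},z^{\pm1}\}$ $$\sqrt{2\,\varepsilon(G,S)/6}\ \ge\ 0.238\qquad\text{and}\qquad \kappa(G,S)\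 \ge\ 0.238 .$$ -/

import Mathlib

open scoped ENNReal LinearAlgebra.Projectivization

universe u₁ u₂ u₃ u₄ w

noncomputable section

/-! ### Laplacian, spectral gap, Kazhdan constant -/

section SpectralGap

variable {G : Type*} [Group G]

/-- The symmetric set `{a, b, c, a⁻¹, b⁻¹, c⁻¹}`, where `x = (a, b, c)`. -/
def symmSet (x : Fin 3 → G) : Finset G := by
  classical exact Finset.univ.image x ∪ Finset.univ.image (fun i => (x i)⁻¹)

/-- The involution `(∑ r_g g)* = ∑ r_g g⁻¹` of the real group ring. -/
def groupRingStar (b : MonoidAlgebra ℝ G) : MonoidAlgebra ℝ G :=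
  MonoidAlgebra.mapDomain (fun g : G => g⁻¹) b

/-- The unnormalized Laplacian `Δ = |S| - ∑_{s ∈ S} s` in the real group ring. -/
def laplacian (S : Finset G) : MonoidAlgebra ℝ G :=
  (S.card : MonoidAlgebra ℝ G) - ∑ s ∈ S, MonoidAlgebra.of ℝ G s

/-- `ε > 0` is a spectral gap (in the sense of Ozawa) if `Δ² - ε Δ` is a finite sum of
hermitian squares `∑ bᵢ* bᵢ` in the real group ring. -/
def IsSpectralGap (S : Finset G) (ε : ℝ) : Prop :=
  0 < ε ∧ ∃ (n : ℕ) (b : Fin n → MonoidAlgebra ℝ G),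
    laplacian S ^ 2 - ε • laplacian S = ∑ i, groupRingStar (b i) * b i

/-- The spectral gap `ε(G, S)`: the supremum, in `[0, ∞]`, of all spectral gaps. -/
def spectralGap (S : Finset G) : ℝ≥0∞ :=
  ⨆ (ε : ℝ) (_ : IsSpectralGap S ε), ENNReal.ofReal ε

/-- `κ(G, S, π) = inf_{‖ξ‖ = 1} max_{s ∈ S} ‖π(s) ξ - ξ‖`. -/
def kazhdanConstantRep {H : Type*} [NormedAddCommGroup H] [InnerProductSpace ℂ H]
    [CompleteSpace H] (S : Finset G) (π : G →* unitary (H →L[ℂ] H)) : ℝ≥0∞ :=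
  ⨅ (ξ : H) (_ : ‖ξ‖ = 1), ⨆ s ∈ S, ENNReal.ofReal ‖(π s : H →L[ℂ] H) ξ - ξ‖

/-- The optimal Kazhdan constant `κ(G, S)`: the infimum of `κ(G, S, π)` over all unitary
representations `π` of `G` without non-zero invariant vectors. -/
def kazhdanConstant (S : Finset G) : ℝ≥0∞ :=
  ⨅ (H : Type w) (_ : NormedAddCommGroup H) (_ : InnerProductSpace ℂ H) (_ : CompleteSpace H)
    (π : G →* unitary (H →L[ℂ] H))
    (_ : ∀ ξ : H, (∀ g, (π g : H →L[ℂ] H) ξ = ξ) → ξ = 0), kazhdanConstantRep S π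

end SpectralGap

/-! ### Ronan's four groups -/

/-- The relators of `G₁, G₂, G₃, G₄` (indexed by `0, 1, 2, 3`); a relation `u = v` is written
as the relator `u * v⁻¹`. -/
def ronanRels (n : Fin 4) : Set (FreeGroup (Fin 3)) :=
  let a : FreeGroup (Fin 3) := FreeGroup.of 0
  let b : FreeGroup (Fin 3) := FreeGroup.of 1
  let c : FreeGroup (Fin 3) := FreeGroup.of 2
  {a ^ 3, b ^ 3, c ^ 3} ∪
    ![{(a * b) ^ 2 * (b * a)⁻¹, (b * c) ^ 2 * (c * b)⁻¹, (c * a) ^ 2 * (a * c)⁻¹},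
      {(a * b) ^ 2 * (b * a)⁻¹, (b * c) ^ 2 * (c * b)⁻¹, (a * c) ^ 2 * (c * a)⁻¹},
      {(a * b) ^ 2 * (b * a)⁻¹, (a * c) ^ 2 * (c * a)⁻¹, (c⁻¹ * b) ^ 2 * (b * c⁻¹)⁻¹},
      {(a * b) ^ 2 * (b * a)⁻¹, (a * c) ^ 2 * (c * a)⁻¹, (b * c⁻¹) ^ 2 * (c⁻¹ * b)⁻¹}] n

/-- Ronan's groups. -/
abbrev RonanGroup (n : Fin 4) : Type := PresentedGroup (ronanRels n)

/-- The generators `a, b, c` of Ronan's groups. -/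
def ronanGen (n : Fin 4) (i : Fin 3) : RonanGroup n := PresentedGroup.of i

/-! ### Trivalent triangle geometries -/

/-- A 2-dimensional complex of triangles with sets of vertices `V`, edges `E` and triangles `T`,
whose vertices have three types such that each triangle has one vertex of each type.
`corner t i` is the vertex of type `i` of `t`, and `side t i` is the edge of `t` opposite to it.
Edges and triangles need not be determined by their vertices, so that simplicial complexes are a
special case. -/
structure TriangleComplex (V E T : Type*) where
  vtype : V → Fin 3
  ends : E → Sym2 V
  corner : T → Fin 3 → V
  side : T → Fin 3 → E
  vtype_corner : ∀ t i, vtype (corner t i) = i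
  ends_side : ∀ t i, ends (side t i) = s(corner t (i + 1), corner t (i + 2))

/-- The incidence graph of the projective plane `PG(2,2)`: its vertices are the points and the
lines; lines are represented by their (dual) homogeneous coordinates. -/
def fanoGraph :
    SimpleGraph (ℙ (ZMod 2) (Fin 3 → ZMod 2) ⊕ ℙ (ZMod 2) (Fin 3 → ZMod 2)) where
  Adj
    | .inl p, .inr l => p.orthogonal l
    | .inr l, .inl p => p.orthogonal l
    | _, _ => False
  symm := ⟨by rintro (p | p) (q | q) <;> simp⟩
  loopless := ⟨by rintro (p | p) <;> simp⟩

namespace TriangleComplex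

variable {V E T : Type*} (X : TriangleComplex V E T)

/-- The 1-skeleton. -/
def oneSkeleton : SimpleGraph V := SimpleGraph.fromRel (fun x y => ∃ e, X.ends e = s(x, y))

/-- The link of the vertex `v` is the graph whose vertices are the edges of `X` at `v` and whose
edges are the triangles of `X` at `v`; the triangle `t` joins its two sides through `v`. This says
that `φ` and the induced map on edges are an isomorphism of this graph onto the incidence graph of
`PG(2,2)`. -/
def LinkIsFano (v : V) : Prop :=
  ∃ φ : E → ℙ (ZMod 2) (Fin 3 → ZMod 2) ⊕ ℙ (ZMod 2) (Fin 3 → ZMod 2),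
    Set.BijOn φ {e | v ∈ X.ends e} Set.univ ∧
    Set.BijOn
      (fun t => s(φ (X.side t (X.vtype v + 1)), φ (X.side t (X.vtype v + 2))))
      {t | X.corner t (X.vtype v) = v} fanoGraph.edgeSet

/-- A trivalent triangle geometry: a connected complex of triangles such that the link of each
vertex is the incidence graph of `PG(2,2)`. -/
def IsTrivalentGeometry : Prop :=
  X.oneSkeleton.Connected ∧ ∀ v, X.LinkIsFano v

variable (G : Type*) [Group G] [MulAction G V] [MulAction G E] [MulAction G T]

/-- `G` acts on `X` by (type preserving) automorphisms. -/
structure ActsByAutomorphisms : Prop where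
  vtype_smul : ∀ (g : G) (v : V), X.vtype (g • v) = X.vtype v
  ends_smul : ∀ (g : G) (e : E), X.ends (g • e) = (X.ends e).map (g • ·)
  corner_smul : ∀ (g : G) (t : T) (i : Fin 3), X.corner (g • t) i = g • X.corner t i
  side_smul : ∀ (g : G) (t : T) (i : Fin 3), X.side (g • t) i = g • X.side t i

variable {G}

/-- Natural generators at the triangle `t`: `x i` generates the stabilizer of the `i`-th side
of `t`. -/
def AreNaturalGenerators (t : T) (x : Fin 3 → G) : Prop :=
  ∀ i, Subgroup.zpowers (x i) = MulAction.stabilizer G (X.side t i)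

end TriangleComplex

end

-- For `s³ = 1` put `P_s = (1 + s + s⁻¹)/3`, in every unitary representation the projection onto the
-- `s`-fixed vectors. For symmetric `S`, `Δ = (3/2) L` with `L = ∑ (1 - P_s)`, so a gap for `Δ` is a
-- statement about angles between these projections.
--
-- If `a³ = 1` and `(ab)² = ba`, then `t = ab` satisfies `ta = at²` and `t⁷ = 1`: the Frobenius
-- group of order 21 appears. In its group ring `P = P_a` and `Q = P_b` satisfy `9PQP - 2P = 9QPQ -
-- 2Q` (`CubeLinked`). Both sides are 7 times the projection onto the common range, and off that
-- range `P` and `Q` make the angle `arccos c`, `c = √2/3`. Hence `(1-P)(1-Q) + (1-Q)(1-P) + c((1-P)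
-- + (1-Q))` is a sum of squares (`CubeLinked.mem_sumsOfSquares`). Summing over pairs of the at most
-- six elements of `S` gives the gap `3 - 2√2` (`laplacian_gap_mem`), and `√((3 - 2√2)/3) = (√2 -
-- 1)/√3 ≈ 0.2391`. The operator inequality `Δ² ≥ εΔ` yields the Kazhdan bound
-- (`le_kazhdanConstant`).
--
-- For a regular action on a geometry, stabilizers of vertices have order 21 and those of edges have
-- order 3, because the Fano incidence graph has 21 edges and is 3-regular. Inside a group of order
-- 21, generators of two different subgroups of order 3 satisfy `(ab)² = ba` up to order and
-- inversion (`exists_frobeniusRel_of_card_eq`). Sorting the orientations and signs of three such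
-- relations leaves exactly Ronan's presentations (`exists_satisfiesRonan`), and connectedness shows
-- that the natural generators generate.

noncomputable section

-- Involution and sums of hermitian squares in the real group ring.

section GroupRingStar

variable {G : Type*} [Group G]

lemma groupRingStar_single (g : G) (r : ℝ) :
    groupRingStar (MonoidAlgebra.single g r) = MonoidAlgebra.single g⁻¹ r := by
  simp [groupRingStar]

lemma groupRingStar_add (x y : MonoidAlgebra ℝ G) :
    groupRingStar (x + y) = groupRingStar x + groupRingStar y :=
  MonoidAlgebra.mapDomain_add _ _ _

lemma groupRingStar_zero : groupRingStar (0 : MonoidAlgebra ℝ G) = 0 :=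
  MonoidAlgebra.mapDomain_zero _

/-- The involution of the group ring as a linear map. -/
def groupRingStarₗ : MonoidAlgebra ℝ G →ₗ[ℝ] MonoidAlgebra ℝ G where
  toFun := groupRingStar
  map_add' := groupRingStar_add
  map_smul' r x := by
    induction x using MonoidAlgebra.induction_linear with
    | zero => simp [groupRingStar_zero]
    | add x y hx hy => rw [smul_add, groupRingStar_add, hx, hy, groupRingStar_add, smul_add]
    | single g s => simp [groupRingStar_single]

lemma groupRingStar_smul (r : ℝ) (x : MonoidAlgebra ℝ G) :
    groupRingStar (r • x) = r • groupRingStar x :=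
  groupRingStarₗ.map_smul r x

lemma groupRingStar_sub (x y : MonoidAlgebra ℝ G) :
    groupRingStar (x - y) = groupRingStar x - groupRingStar y :=
  groupRingStarₗ.map_sub x y

lemma groupRingStar_one : groupRingStar (1 : MonoidAlgebra ℝ G) = 1 := by
  simp [MonoidAlgebra.one_def, groupRingStar_single]

lemma groupRingStar_mul (x y : MonoidAlgebra ℝ G) :
    groupRingStar (x * y) = groupRingStar y * groupRingStar x := by
  induction x using MonoidAlgebra.induction_linear with
  | zero => simp [groupRingStar_zero]
  | add x x' hx hx' => rw [add_mul, groupRingStar_add, hx, hx', groupRingStar_add, mul_add]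
  | single g r =>
    induction y using MonoidAlgebra.induction_linear with
    | zero => simp [groupRingStar_zero]
    | add y y' hy hy' => rw [mul_add, groupRingStar_add, hy, hy', groupRingStar_add, add_mul]
    | single h s => simp [groupRingStar_single, MonoidAlgebra.single_mul_single, mul_comm]

/-- The cone of sums of hermitian squares in the real group ring. -/
def sumsOfSquares (G : Type*) [Group G] : AddSubmonoid (MonoidAlgebra ℝ G) :=
  AddSubmonoid.closure (Set.range fun b => groupRingStar b * b)

lemma smul_star_mul_self_mem {r : ℝ} (hr : 0 ≤ r) {b : MonoidAlgebra ℝ G}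
    (hb : groupRingStar b = b) : r • (b * b) ∈ sumsOfSquares G := by
  refine AddSubmonoid.subset_closure ⟨√r • b, ?_⟩
  simp only [groupRingStar_smul, hb, smul_mul_smul_comm, Real.mul_self_sqrt hr]

lemma smul_mem_sumsOfSquares {r : ℝ} (hr : 0 ≤ r) {x : MonoidAlgebra ℝ G}
    (hx : x ∈ sumsOfSquares G) : r • x ∈ sumsOfSquares G := by
  induction hx using AddSubmonoid.closure_induction with
  | mem x hx =>
    obtain ⟨b, rfl⟩ := hx
    refine AddSubmonoid.subset_closure ⟨√r • b, ?_⟩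
    simp only [groupRingStar_smul, smul_mul_smul_comm, Real.mul_self_sqrt hr]
  | zero => simp [zero_mem]
  | add x y _ _ hx hy => rw [smul_add]; exact add_mem hx hy

lemma exists_fin_of_mem_sumsOfSquares {x : MonoidAlgebra ℝ G} (hx : x ∈ sumsOfSquares G) :
    ∃ (n : ℕ) (b : Fin n → MonoidAlgebra ℝ G), x = ∑ i, groupRingStar (b i) * b i := by
  induction hx using AddSubmonoid.closure_induction with
  | mem x hx =>
    obtain ⟨b, rfl⟩ := hx
    exact ⟨1, fun _ => b, by simp⟩
  | zero => exact ⟨0, Fin.elim0, by simp⟩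
  | add x y _ _ hx hy =>
    obtain ⟨m, b, rfl⟩ := hx
    obtain ⟨n, d, rfl⟩ := hy
    exact ⟨m + n, Fin.append b d, by simp [Fin.sum_univ_add]⟩

end GroupRingStar

-- Two projections at a fixed angle.

section Projections

/-- The quadratic polynomial in two projections at angle `arccos c`, `c² = 2/9`, written as a
combination of two squares. -/
lemma sum_sub_sub_eq_squares {A : Type*} [Ring A] [Algebra ℝ A] {x y : A} {c : ℝ}
    (hc : c ^ 2 = 2 / 9) (hx : x * x = x) (hy : y * y = y)
    (h : (9 : ℝ) • (x * y * x) - (2 : ℝ) • x = (9 : ℝ) • (y * x * y) - (2 : ℝ) • y)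
    {z m p q : A} (hz : z = (7⁻¹ : ℝ) • ((9 : ℝ) • (x * y * x) - (2 : ℝ) • x)) (hm : m = x + y)
    (hp : p = (7 : ℝ) • (1 - z) - (9 : ℝ) • ((2 : ℝ) • m - m * m))
    (hq : q = (1 + c) • m - m * m + (2 * (1 - c)) • z) :
    (1 - x) * (1 - y) + (1 - y) * (1 - x) + c • ((1 - x) + (1 - y)) =
      (2 * (1 + c) / 49) • (p * p) + (729 / 196 * c * (1 + c) ^ 3) • (q * q) := by
  -- `z` is the projection onto the common range of `x` and `y`. The relation `hm3` says that `m = x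
  -- + y` has eigenvalue 2 on `z`, and otherwise only `0` and the roots `1 ± c` of `m² - 2m + 7/9`.
  have hz' : z = (7⁻¹ : ℝ) • ((9 : ℝ) • (y * x * y) - (2 : ℝ) • y) := by rw [hz, h]
  have hxz : x * z = z := by
    rw [hz, mul_smul_comm, mul_sub, mul_smul_comm, mul_smul_comm, ← mul_assoc, ← mul_assoc, hx]
  have hzx : z * x = z := by
    rw [hz, smul_mul_assoc, sub_mul, smul_mul_assoc, smul_mul_assoc, mul_assoc, hx]
  have hyz : y * z = z := by
    rw [hz', mul_smul_comm, mul_sub, mul_smul_comm, mul_smul_comm, ← mul_assoc, ← mul_assoc, hy]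
  have hzy : z * y = z := by
    rw [hz', smul_mul_assoc, sub_mul, smul_mul_assoc, smul_mul_assoc, mul_assoc, hy]
  have hzz : z * z = z := by
    nth_rewrite 1 [hz]
    rw [smul_mul_assoc, sub_mul, smul_mul_assoc, smul_mul_assoc, mul_assoc, mul_assoc, hxz, hyz,
      hxz]
    module
  have hmz : m * z = (2 : ℝ) • z := by rw [hm, add_mul, hxz, hyz, two_smul]
  have hzm : z * m = (2 : ℝ) • z := by rw [hm, mul_add, hzx, hzy, two_smul]
  have hxyx : x * (y * x) = (9⁻¹ : ℝ) • ((7 : ℝ) • z + (2 : ℝ) • x) := by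
    rw [hz, mul_assoc]; module
  have hyxy : y * (x * y) = (9⁻¹ : ℝ) • ((7 : ℝ) • z + (2 : ℝ) • y) := by
    rw [hz', mul_assoc]; module
  have hm2 : m * m = m + (x * y + y * x) := by
    rw [hm, add_mul, mul_add, mul_add, hx, hy]; abel
  have hm3 : m * (m * m) = (2 : ℝ) • (m * m) - (7 / 9 : ℝ) • m + (14 / 9 : ℝ) • z := by
    have e : m * (x * y + y * x) = x * y + y * x + (9⁻¹ : ℝ) • ((14 : ℝ) • z + (2 : ℝ) • m) := by
      rw [hm, mul_add, add_mul, add_mul, ← mul_assoc x x, hx, ← mul_assoc y y, hy, hxyx, hyxy]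
      module
    rw [hm2, mul_add, e, hm2]
    module
  have hzmm : z * (m * m) = (4 : ℝ) • z := by
    rw [← mul_assoc, hzm, smul_mul_assoc, hzm]; module
  -- `p` is 7 times the projection onto the eigenspace `m = 0`, and `q` is `2c(1 - c)` times the one
  -- for `m = 1 - c`.
  have hpp : p * p = (49 : ℝ) • (1 - z) - (63 : ℝ) • ((2 : ℝ) • m - m * m) := by
    rw [hp]
    simp only [mul_sub, sub_mul, mul_add, smul_sub, smul_add, mul_smul_comm, smul_mul_assoc, mul_one, one_mul,
      mul_assoc, hzz, hmz, hzm, hzmm, hm3]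
    module
  have hqq : q * q = (2 * c * (1 - c)) • q := by
    rw [hq]
    simp only [mul_sub, sub_mul, mul_add, add_mul, mul_smul_comm, smul_mul_assoc,
      mul_assoc, hzz, hmz, hzm, hzmm, hm3]
    match_scalars <;> grind
  -- The polynomial is `(m - 2)(m - (1 + c))`. It vanishes at `2` and `1 + c` and takes the positive
  -- values `2(1 + c)` at `0` and `2c(1 + c)` at `1 - c`; this fixes the coefficients of `p²` and
  -- `q²`.
  have hl : (1 - x) * (1 - y) + (1 - y) * (1 - x) + c • ((1 - x) + (1 - y)) =
      (2 * (1 + c)) • (1 : A) - (3 + c) • m + m * m := by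
    rw [hm2, hm, mul_sub, sub_mul, sub_mul, mul_sub, sub_mul, sub_mul]
    simp only [mul_one, one_mul]
    module
  rw [hl, hpp, hqq, hq]
  match_scalars <;> grind

end Projections

-- The Frobenius group of order 21 and its cube projections.

section FrobeniusRelation

/-- Here `y = 1 + b + b⁻¹` for `b = a²t`, `b⁻¹ = at⁵`. Moving every `t` to the right by `ta = at²`
brings all words to the form `aⁱtʲ`, and the two sides then agree term by term. -/
lemma frobenius_relation_aux {A : Type*} [Ring A] {a t : A} (ha : a * (a * a) = 1)
    (ht : t * (t * (t * (t * (t * (t * t))))) = 1) (hta : t * a = a * (t * t)) {x y : A}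
    (hx : x = 1 + a + a * a) (hy : y = 1 + a * (a * t) + a * (t * (t * (t * (t * t))))) :
    x * y * x - (2 : ℕ) • x = y * x * y - (2 : ℕ) • y := by
  have ha' (u : A) : a * (a * (a * u)) = u := by simpa [mul_assoc] using congr($ha * u)
  have hta' (u : A) : t * (a * u) = a * (t * (t * u)) := by
    simpa [mul_assoc] using congr($hta * u)
  subst hx hy
  simp only [mul_add, add_mul, mul_one, one_mul, mul_assoc, ha, ha', ht, hta, hta']
  abel

variable {G : Type*} [Group G]

/-- The average of `1, g, g⁻¹` in the group ring; it is a projection when `g ^ 3 = 1`. -/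
def cubeProj (g : G) : MonoidAlgebra ℝ G :=
  (3⁻¹ : ℝ) • (1 + MonoidAlgebra.of ℝ G g + MonoidAlgebra.of ℝ G g⁻¹)

lemma cubeProj_inv (g : G) : cubeProj g⁻¹ = cubeProj g := by
  rw [cubeProj, cubeProj, inv_inv, add_right_comm]

lemma groupRingStar_of (g : G) :
    groupRingStar (MonoidAlgebra.of ℝ G g) = MonoidAlgebra.of ℝ G g⁻¹ :=
  groupRingStar_single g 1

lemma groupRingStar_cubeProj (g : G) : groupRingStar (cubeProj g) = cubeProj g := by
  rw [cubeProj, groupRingStar_smul, groupRingStar_add, groupRingStar_add, groupRingStar_one,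
    groupRingStar_of, groupRingStar_of, inv_inv, add_right_comm]

lemma cubeProj_mul_self {g : G} (hg : g ^ 3 = 1) : cubeProj g * cubeProj g = cubeProj g := by
  have h1 : g⁻¹ * g⁻¹ = g := by
    rw [← mul_inv_rev, inv_eq_iff_mul_eq_one, ← pow_two, ← pow_succ, hg]
  have h2 : g * g = g⁻¹ := by rw [eq_inv_iff_mul_eq_one, ← pow_two, ← pow_succ, hg]
  rw [cubeProj, smul_mul_smul_comm]
  simp only [mul_add, add_mul, mul_one, one_mul, ← map_mul, h1, h2, mul_inv_cancel,
    inv_mul_cancel, map_one]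
  module

/-- The relation between `P = cubeProj a` and `Q = cubeProj b` that holds when `a` and `b` are
elements of order three that generate a Frobenius group of order 21. -/
def CubeLinked (a b : G) : Prop :=
  (9 : ℝ) • (cubeProj a * cubeProj b * cubeProj a) - (2 : ℝ) • cubeProj a =
    (9 : ℝ) • (cubeProj b * cubeProj a * cubeProj b) - (2 : ℝ) • cubeProj b

lemma CubeLinked.symm {a b : G} (h : CubeLinked a b) : CubeLinked b a := Eq.symm h

lemma CubeLinked.inv_left {a b : G} (h : CubeLinked a b) : CubeLinked a⁻¹ b := by
  rwa [CubeLinked, cubeProj_inv]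

lemma CubeLinked.inv_right {a b : G} (h : CubeLinked a b) : CubeLinked a b⁻¹ := by
  rwa [CubeLinked, cubeProj_inv]

/-- If `a³ = b³ = 1` and `(ab)² = ba`, then `t = ab` satisfies `ta = at²`, `t⁷ = 1`. -/
lemma frobenius_relations {a b : G} (ha : a ^ 3 = 1) (hab : (a * b) ^ 2 = b * a) :
    a * b * a = a * (a * b) ^ 2 ∧ (a * b) ^ 7 = 1 := by
  have h : a * b * a = a * (a * b) ^ 2 := by rw [hab, mul_assoc]
  have hs : SemiconjBy a ((a * b) ^ 2) (a * b) := h.symm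
  refine ⟨h, ?_⟩
  -- Conjugation by `a⁻¹` squares `t = ab`; three times gives `t⁸ = t`, as `a³ = 1`.
  have h3 : SemiconjBy (a ^ 3) ((a * b) ^ 8) (a * b) := by
    have h1 := hs.pow_right 4
    have h2 := hs.pow_right 2
    rw [← pow_mul] at h1 h2
    have := (hs.mul_left h2).mul_left h1
    simpa [pow_succ, mul_assoc] using this
  rw [ha, SemiconjBy, one_mul, mul_one, pow_succ] at h3
  simpa using h3

lemma cubeLinked_of_sq_mul_eq {a b : G} (ha : a ^ 3 = 1)
    (hab : (a * b) ^ 2 = b * a) : CubeLinked a b := by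
  obtain ⟨hta, ht⟩ := frobenius_relations ha hab
  have ha2 : a⁻¹ = a * a := by rw [inv_eq_iff_mul_eq_one, ← pow_two, ← pow_succ', ha]
  have hb' : b = a * (a * (a * b)) := by
    rw [← mul_assoc, ← mul_assoc, ← pow_two, ← pow_succ, ha, one_mul]
  have hb2 : b⁻¹ = a * ((a * b) * ((a * b) * ((a * b) * ((a * b) * (a * b))))) := by
    have h5 : (a * b) * ((a * b) * ((a * b) * ((a * b) * (a * b)))) = ((a * b) ^ 2)⁻¹ := by
      rw [eq_inv_iff_mul_eq_one, ← ht]; simp only [pow_succ, pow_zero, one_mul, mul_assoc]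
    rw [h5, hab]; group
  have key := frobenius_relation_aux (a := MonoidAlgebra.of ℝ G a)
    (t := MonoidAlgebra.of ℝ G (a * b)) (by rw [← map_mul, ← map_mul, ← pow_two, ← pow_succ', ha, map_one])
    (by rw [← map_one (MonoidAlgebra.of ℝ G), ← ht]
        simp only [pow_succ, pow_zero, one_mul, mul_assoc, map_mul])
    (by rw [← map_mul, ← map_mul, ← map_mul, hta, pow_two])
    (x := 1 + MonoidAlgebra.of ℝ G a + MonoidAlgebra.of ℝ G a⁻¹)
    (y := 1 + MonoidAlgebra.of ℝ G b + MonoidAlgebra.of ℝ G b⁻¹)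
    (by rw [ha2, map_mul]) (by nth_rewrite 1 [hb', hb2]; simp only [map_mul])
  rw [CubeLinked, cubeProj, cubeProj]
  simp only [smul_mul_assoc, mul_smul_comm, smul_smul]
  convert congr((3⁻¹ : ℝ) • $key) using 1 <;> module

/-- The angle of `√2 / 3` between linked projections. -/
lemma CubeLinked.mem_sumsOfSquares {a b : G} (h : CubeLinked a b) (ha : a ^ 3 = 1)
    (hb : b ^ 3 = 1) :
    (1 - cubeProj a) * (1 - cubeProj b) + (1 - cubeProj b) * (1 - cubeProj a) +
      (√2 / 3) • ((1 - cubeProj a) + (1 - cubeProj b)) ∈ sumsOfSquares G := by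
  have hc : (√2 / 3) ^ 2 = 2 / 9 := by rw [div_pow, Real.sq_sqrt] <;> norm_num
  rw [sum_sub_sub_eq_squares hc (cubeProj_mul_self ha) (cubeProj_mul_self hb) h rfl rfl rfl rfl]
  refine add_mem (smul_star_mul_self_mem (by positivity) ?_)
    (smul_star_mul_self_mem (by positivity) ?_) <;>
  · simp only [groupRingStar_add, groupRingStar_sub, groupRingStar_smul, groupRingStar_mul,
      groupRingStar_one, groupRingStar_cubeProj, mul_assoc]

end FrobeniusRelation

-- The spectral gap of the Laplacian.

section LaplacianGap

variable {G : Type*} [Group G]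

lemma one_sub_cubeProj_mul_self {g : G} (hg : g ^ 3 = 1) :
    (1 - cubeProj g) * (1 - cubeProj g) = 1 - cubeProj g := by
  rw [sub_mul, mul_sub, mul_sub, cubeProj_mul_self hg]; simp

lemma one_sub_cubeProj_mem {g : G} (hg : g ^ 3 = 1) : 1 - cubeProj g ∈ sumsOfSquares G := by
  have := smul_star_mul_self_mem zero_le_one (b := 1 - cubeProj g)
    (by rw [groupRingStar_sub, groupRingStar_one, groupRingStar_cubeProj])
  rwa [one_smul, one_sub_cubeProj_mul_self hg] at this

lemma cubeProj_one : cubeProj (1 : G) = 1 := by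
  rw [cubeProj, inv_one, map_one]; module

lemma laplacian_eq_sum_cubeProj {S : Finset G} (hS : ∀ s ∈ S, s⁻¹ ∈ S) :
    laplacian S = (3 / 2 : ℝ) • ∑ s ∈ S, (1 - cubeProj s) := by
  have hinv : ∑ s ∈ S, MonoidAlgebra.of ℝ G s⁻¹ = ∑ s ∈ S, MonoidAlgebra.of ℝ G s :=
    Finset.sum_nbij' (·⁻¹) (·⁻¹) hS hS (by simp) (by simp) (by simp)
  have h1 : ∀ s : G, 1 - cubeProj s = (3⁻¹ : ℝ) •
      ((2 : ℝ) • (1 : MonoidAlgebra ℝ G) - MonoidAlgebra.of ℝ G s - MonoidAlgebra.of ℝ G s⁻¹) := by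
    intro s; rw [cubeProj]; module
  rw [Finset.sum_congr rfl fun s _ => h1 s, ← Finset.smul_sum, Finset.sum_sub_distrib,
    Finset.sum_sub_distrib, hinv, laplacian, Finset.sum_const, ← nsmul_one S.card]
  module

lemma inv_ne_self_of_pow_three {g : G} (hg : g ^ 3 = 1) (h1 : g ≠ 1) : g⁻¹ ≠ g := by
  intro h
  apply h1
  have h2 : g * g = 1 := by nth_rewrite 1 [← h]; exact inv_mul_cancel g
  rwa [pow_succ, pow_two, h2, one_mul] at hg

/-- A finite symmetric set of at most six elements of order three, any two of which are
mutually inverse or linked, has spectral gap `3 - 2√2`. -/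
theorem laplacian_gap_mem {S : Finset G} (hS : ∀ s ∈ S, s⁻¹ ∈ S) (h3 : ∀ s ∈ S, s ^ 3 = 1)
    (hcard : S.card ≤ 6)
    (hl : ∀ s ∈ S, ∀ t ∈ S, (t = s ∨ t = s⁻¹) ∨ CubeLinked s t) :
    laplacian S ^ 2 - (3 - 2 * √2) • laplacian S ∈ sumsOfSquares G := by
  classical
  set Q : G → MonoidAlgebra ℝ G := fun s => 1 - cubeProj s with hQ
  set L := ∑ s ∈ S, Q s with hL
  have hinv : ∀ s, Q s⁻¹ = Q s := fun s => by simp only [hQ, cubeProj_inv]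
  -- For `t = s` or `t = s⁻¹` the pair contributes exactly `2(1 + c) Q s`; subtracting this is where
  -- the gap comes from.
  have hterm : ∀ s ∈ S, ∀ t ∈ S, Q s * Q t + Q t * Q s + (√2 / 3) • (Q s + Q t)
      - (if t = s ∨ t = s⁻¹ then (2 * (1 + √2 / 3)) • Q s else 0) ∈ sumsOfSquares G := by
    intro s hs t ht
    split_ifs with h
    · have hts : Q t = Q s := by rcases h with rfl | rfl <;> simp [hinv]
      have hss : Q s * Q s = Q s := one_sub_cubeProj_mul_self (h3 s hs)
      rw [hts, hss]
      convert zero_mem (sumsOfSquares G) using 1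
      module
    · rw [sub_zero]
      exact ((hl s hs t ht).resolve_left h).mem_sumsOfSquares (h3 s hs) (h3 t ht)
  have hsum := sum_mem fun s hs => sum_mem (hterm s hs)
  have hdiag : ∀ s ∈ S, ∑ t ∈ S, (if t = s ∨ t = s⁻¹ then (2 * (1 + √2 / 3)) • Q s else 0) =
      (4 * (1 + √2 / 3)) • Q s := by
    intro s hs
    rw [← Finset.sum_filter, Finset.sum_const]
    -- For `s = 1` the set `{s, s⁻¹}` has one element only, but `Q 1 = 0`.
    by_cases h1 : s = 1
    · simp [h1, hQ, cubeProj_one]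
    · have : S.filter (fun t => t = s ∨ t = s⁻¹) = {s, s⁻¹} := by
        ext t
        simp only [Finset.mem_filter, Finset.mem_insert, Finset.mem_singleton,
          and_iff_right_iff_imp]
        rintro (rfl | rfl)
        exacts [hs, hS _ hs]
      rw [this, Finset.card_pair (inv_ne_self_of_pow_three (h3 s hs) h1).symm]
      module
  have hE : ∑ s ∈ S, ∑ t ∈ S, (Q s * Q t + Q t * Q s + (√2 / 3) • (Q s + Q t)
      - (if t = s ∨ t = s⁻¹ then (2 * (1 + √2 / 3)) • Q s else 0)) =
      (2 : ℝ) • (L * L) + (2 * (√2 / 3) * S.card - 4 * (1 + √2 / 3)) • L := by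
    simp only [Finset.sum_sub_distrib]
    rw [Finset.sum_congr rfl hdiag]
    simp only [Finset.sum_add_distrib, smul_add, ← Finset.mul_sum, ← Finset.sum_mul,
      ← Finset.smul_sum, Finset.sum_const]
    rw [← hL]
    module
  rw [hE] at hsum
  have hLmem : L ∈ sumsOfSquares G := sum_mem fun s hs => one_sub_cubeProj_mem (h3 s hs)
  have hcard' : (0 : ℝ) ≤ 6 - S.card := by
    rw [sub_nonneg]; exact_mod_cast hcard
  -- The factor `9/8` turns `2L²` into `Δ² = (9/4)L²`. The second summand replaces `S.card` by 6
  -- when generators coincide.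
  have hfin := add_mem (smul_mem_sumsOfSquares (r := 9 / 8) (by norm_num) hsum)
    (smul_mem_sumsOfSquares (r := 9 / 8 * (2 * (√2 / 3) * (6 - S.card))) (by positivity) hLmem)
  rw [laplacian_eq_sum_cubeProj hS, ← hL, pow_two, smul_mul_smul_comm]
  convert hfin using 1
  module

end LaplacianGap

-- From a spectral gap to the Kazhdan constant.

section Kazhdan

open scoped InnerProductSpace

variable {H : Type*} [NormedAddCommGroup H] [InnerProductSpace ℂ H] [CompleteSpace H]

/-- With `R = √T`, the inequality `ε⟨Tη, η⟩ ≤ ⟨T²η, η⟩` is the claim for `ξ = Rη`. Since `R` is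
self-adjoint with trivial kernel, such vectors are dense. -/
lemma ContinuousLinearMap.mul_norm_sq_le_of_smul_le_mul_self {T : H →L[ℂ] H} (hT : 0 ≤ T)
    {ε : ℝ} (h : 0 ≤ T * T - ε • T) (hker : ∀ ξ, T ξ = 0 → ξ = 0) (ξ : H) :
    ε * ‖ξ‖ ^ 2 ≤ (⟪T ξ, ξ⟫_ℂ).re := by
  set R := CFC.sqrt T with hR
  have hRR : R * R = T := CFC.sqrt_mul_sqrt_self T hT
  have hRs : ContinuousLinearMap.adjoint R = R :=
    (IsSelfAdjoint.of_nonneg (CFC.sqrt_nonneg T)).star_eq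
  have hT' : ∀ ζ, (⟪T ζ, ζ⟫_ℂ).re = ‖R ζ‖ ^ 2 := fun ζ => by
    rw [← hRR, mul_apply_eq_comp, ← ContinuousLinearMap.adjoint_inner_right, hRs,
      ← inner_self_eq_norm_sq (𝕜 := ℂ)]; rfl
  have hTT : ∀ ζ, (⟪T (T ζ), ζ⟫_ℂ).re = ‖T ζ‖ ^ 2 := fun ζ => by
    have : ContinuousLinearMap.adjoint T = T := (IsSelfAdjoint.of_nonneg hT).star_eq
    rw [← ContinuousLinearMap.adjoint_inner_right, this, ← inner_self_eq_norm_sq (𝕜 := ℂ)]; rfl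
  rw [hT']
  have hdense : DenseRange R := by
    have hb : (LinearMap.range (R : H →ₗ[ℂ] H))ᗮ = ⊥ := by
      rw [eq_bot_iff]
      intro ζ hζ
      rw [Submodule.mem_orthogonal] at hζ
      have : R ζ = 0 := by
        have h0 : ⟪R (R ζ), ζ⟫_ℂ = 0 := hζ _ ⟨R ζ, rfl⟩
        rwa [← ContinuousLinearMap.adjoint_inner_right, hRs, inner_self_eq_zero] at h0
      exact hker ζ (by rw [← hRR, mul_apply_eq_comp, this, map_zero])
    have := (Submodule.dense_iff_topologicalClosure_eq_top
      (s := LinearMap.range (R : H →ₗ[ℂ] H))).2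
      ((Submodule.topologicalClosure_eq_top_iff).2 hb)
    exact this
  refine hdense.induction_on (p := fun ξ => ε * ‖ξ‖ ^ 2 ≤ ‖R ξ‖ ^ 2) ξ ?_ ?_
  · exact isClosed_le (by fun_prop) (by fun_prop)
  · intro η
    have h1 := (ContinuousLinearMap.nonneg_iff_isPositive _).1 h
    have h2 := h1.re_inner_nonneg_left η
    have h3 : R (R η) = T η := by rw [← hRR]; rfl
    rw [h3, ← hT', ← hTT]
    have h4 : (⟪(T * T - ε • T) η, η⟫_ℂ).re = (⟪T (T η), η⟫_ℂ).re - ε * (⟪T η, η⟫_ℂ).re := by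
      simp [inner_smul_left_eq_smul]
    have h5 : 0 ≤ (⟪(T * T - ε • T) η, η⟫_ℂ).re := h2
    linarith

variable {G : Type*} [Group G]

/-- The extension of a unitary representation to the real group ring. -/
def repGroupRing (π : G →* unitary (H →L[ℂ] H)) : MonoidAlgebra ℝ G →ₐ[ℝ] (H →L[ℂ] H) :=
  MonoidAlgebra.lift ℝ (H →L[ℂ] H) G ((unitary (H →L[ℂ] H)).subtype.comp π)

lemma repGroupRing_of (π : G →* unitary (H →L[ℂ] H)) (g : G) :
    repGroupRing π (MonoidAlgebra.of ℝ G g) = (π g : H →L[ℂ] H) :=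
  MonoidAlgebra.lift_of _ _

lemma repGroupRing_star (π : G →* unitary (H →L[ℂ] H)) (b : MonoidAlgebra ℝ G) :
    repGroupRing π (groupRingStar b) = star (repGroupRing π b) := by
  induction b using MonoidAlgebra.induction_linear with
  | zero => simp [groupRingStar_zero]
  | add x y hx hy => rw [groupRingStar_add, map_add, hx, hy, map_add, star_add]
  | single g r =>
    rw [groupRingStar_single, repGroupRing, MonoidAlgebra.lift_single, MonoidAlgebra.lift_single,
      star_smul, star_trivial]
    simp [← Unitary.star_eq_inv]

lemma repGroupRing_nonneg (π : G →* unitary (H →L[ℂ] H)) {x : MonoidAlgebra ℝ G}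
    (hx : x ∈ sumsOfSquares G) : 0 ≤ repGroupRing π x := by
  induction hx using AddSubmonoid.closure_induction with
  | mem x hx =>
    obtain ⟨b, rfl⟩ := hx
    simp only [map_mul, repGroupRing_star]
    exact star_mul_self_nonneg _
  | zero => rw [map_zero]
  | add x y _ _ hx hy => rw [map_add]; exact add_nonneg hx hy

lemma two_smul_laplacian {S : Finset G} (hS : ∀ s ∈ S, s⁻¹ ∈ S) :
    (2 : ℝ) • laplacian S = ∑ s ∈ S, groupRingStar (1 - MonoidAlgebra.of ℝ G s) *
      (1 - MonoidAlgebra.of ℝ G s) := by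
  have hinv : ∑ s ∈ S, MonoidAlgebra.of ℝ G s⁻¹ = ∑ s ∈ S, MonoidAlgebra.of ℝ G s :=
    Finset.sum_nbij' (·⁻¹) (·⁻¹) hS hS (by simp) (by simp) (by simp)
  have h1 : ∀ s : G, groupRingStar (1 - MonoidAlgebra.of ℝ G s) * (1 - MonoidAlgebra.of ℝ G s) =
      (2 : ℝ) • (1 : MonoidAlgebra ℝ G) - MonoidAlgebra.of ℝ G s - MonoidAlgebra.of ℝ G s⁻¹ := by
    intro s
    rw [groupRingStar_sub, groupRingStar_one, groupRingStar_of, mul_sub, sub_mul, sub_mul,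
      ← map_mul, inv_mul_cancel, map_one]
    simp only [mul_one, one_mul]
    module
  rw [Finset.sum_congr rfl fun s _ => h1 s, Finset.sum_sub_distrib, Finset.sum_sub_distrib, hinv,
    laplacian, Finset.sum_const, ← nsmul_one S.card]
  module

lemma laplacian_mem_sumsOfSquares {S : Finset G} (hS : ∀ s ∈ S, s⁻¹ ∈ S) :
    laplacian S ∈ sumsOfSquares G := by
  have : laplacian S = (2⁻¹ : ℝ) • ((2 : ℝ) • laplacian S) := by module
  rw [this, two_smul_laplacian hS]
  exact smul_mem_sumsOfSquares (by norm_num)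
    (sum_mem fun s _ => AddSubmonoid.subset_closure ⟨_, rfl⟩)

lemma two_mul_re_inner_laplacian {S : Finset G} (hS : ∀ s ∈ S, s⁻¹ ∈ S)
    (π : G →* unitary (H →L[ℂ] H)) (ξ : H) :
    2 * (⟪repGroupRing π (laplacian S) ξ, ξ⟫_ℂ).re =
      ∑ s ∈ S, ‖(π s : H →L[ℂ] H) ξ - ξ‖ ^ 2 := by
  have h := congr((⟪repGroupRing π $(two_smul_laplacian hS) ξ, ξ⟫_ℂ).re)
  rw [map_smul, smul_apply, inner_smul_left_eq_smul, map_sum,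
    sum_apply, sum_inner, Complex.re_sum] at h
  have h2 : 2 * (⟪repGroupRing π (laplacian S) ξ, ξ⟫_ℂ).re =
      ((2 : ℝ) • ⟪repGroupRing π (laplacian S) ξ, ξ⟫_ℂ).re := by simp
  rw [h2, h]
  refine Finset.sum_congr rfl fun s _ => ?_
  rw [map_mul, repGroupRing_star, mul_apply_eq_comp,
    ContinuousLinearMap.star_eq_adjoint, ContinuousLinearMap.adjoint_inner_left, map_sub, map_one,
    repGroupRing_of, norm_sub_rev, ← inner_self_eq_norm_sq (𝕜 := ℂ)]
  rfl

/-- A spectral gap gives a lower bound for the Kazhdan constant. -/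
theorem le_kazhdanConstant {S : Finset G} (hS : ∀ s ∈ S, s⁻¹ ∈ S)
    (hgen : Subgroup.closure (S : Set G) = ⊤) {ε r : ℝ} (hr : 0 ≤ r)
    (hrε : S.card * r ^ 2 < 2 * ε)
    (hgap : laplacian S ^ 2 - ε • laplacian S ∈ sumsOfSquares G) :
    ENNReal.ofReal r ≤ kazhdanConstant.{w} S := by
  refine le_iInf fun H => le_iInf fun _ => le_iInf fun _ => le_iInf fun _ => le_iInf fun π =>
    le_iInf fun hπ => le_iInf fun ξ => le_iInf fun hξ => ?_
  have hsum := two_mul_re_inner_laplacian hS π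
  have hT := repGroupRing_nonneg π (laplacian_mem_sumsOfSquares hS)
  have hgap' := repGroupRing_nonneg π hgap
  rw [map_sub, map_smul, pow_two, map_mul] at hgap'
  have hker : ∀ ζ, repGroupRing π (laplacian S) ζ = 0 → ζ = 0 := by
    intro ζ hζ
    have h0 := hsum ζ
    rw [hζ, inner_zero_left, Complex.zero_re, mul_zero, eq_comm,
      Finset.sum_eq_zero_iff_of_nonneg fun _ _ => by positivity] at h0
    apply hπ
    intro g
    have hg : g ∈ Subgroup.closure (S : Set G) := hgen ▸ Subgroup.mem_top g
    induction hg using Subgroup.closure_induction with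
    | mem s hs => simpa [sub_eq_zero] using h0 s hs
    | one => simp
    | mul x y _ _ hx hy =>
      rw [map_mul, Submonoid.coe_mul, mul_apply_eq_comp, hy, hx]
    | inv x _ hx =>
      nth_rewrite 1 [← hx]
      rw [← mul_apply_eq_comp, ← Submonoid.coe_mul, ← map_mul, inv_mul_cancel,
        map_one]
      rfl
  have hmain := ContinuousLinearMap.mul_norm_sq_le_of_smul_le_mul_self hT hgap' hker ξ
  rw [hξ, one_pow, mul_one] at hmain
  by_contra! hlt
  -- Weak inequalities suffice here, because `hrε` is strict.
  have hlt' : ∀ s ∈ S, ‖(π s : H →L[ℂ] H) ξ - ξ‖ ^ 2 ≤ r ^ 2 := by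
    intro s hs
    have h1 : ENNReal.ofReal ‖(π s : H →L[ℂ] H) ξ - ξ‖ ≤ ENNReal.ofReal r :=
      (le_iSup₂ (f := fun s (_ : s ∈ S) => ENNReal.ofReal ‖(π s : H →L[ℂ] H) ξ - ξ‖)
        s hs).trans hlt.le
    exact pow_le_pow_left₀ (norm_nonneg _) ((ENNReal.ofReal_le_ofReal_iff hr).1 h1) 2
  have := Finset.sum_le_card_nsmul S _ _ hlt'
  rw [← hsum, nsmul_eq_mul] at this
  linarith

end Kazhdan

-- Numerical bounds for three generators.

section ThreeGenerators

variable {G : Type*} [Group G]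

lemma mem_symmSet {x : Fin 3 → G} {s : G} : s ∈ symmSet x ↔ ∃ i, s = x i ∨ s = (x i)⁻¹ := by
  simp only [symmSet, Finset.mem_union, Finset.mem_image, Finset.mem_univ, true_and, eq_comm,
    ← exists_or]

lemma card_symmSet_le (x : Fin 3 → G) : (symmSet x).card ≤ 6 := by
  classical
  rw [symmSet]
  exact (Finset.card_union_le _ _).trans
    (add_le_add Finset.card_image_le Finset.card_image_le)

/-- The bounds for the spectral gap and the Kazhdan constant of a group that is generated by three
elements of order three which pairwise generate Frobenius groups of order 21. -/
theorem spectral_bounds_of_cubeLinked {x : Fin 3 → G} (h3 : ∀ i, x i ^ 3 = 1)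
    (hl : ∀ i j, i ≠ j → CubeLinked (x i) (x j)) (hgen : Subgroup.closure (Set.range x) = ⊤) :
    ENNReal.ofReal 0.238 ≤ (2 * spectralGap (symmSet x) / 6) ^ (1 / 2 : ℝ) ∧
      ENNReal.ofReal 0.238 ≤ kazhdanConstant.{w} (symmSet x) := by
  have hS : ∀ s ∈ symmSet x, s⁻¹ ∈ symmSet x := by
    simp only [mem_symmSet]
    rintro s ⟨i, rfl | rfl⟩
    exacts [⟨i, .inr rfl⟩, ⟨i, .inl (inv_inv _)⟩]
  have hS3 : ∀ s ∈ symmSet x, s ^ 3 = 1 := by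
    simp only [mem_symmSet]
    rintro s ⟨i, rfl | rfl⟩
    exacts [h3 i, by rw [inv_pow, h3, inv_one]]
  have hSl : ∀ s ∈ symmSet x, ∀ t ∈ symmSet x, (t = s ∨ t = s⁻¹) ∨ CubeLinked s t := by
    simp only [mem_symmSet]
    rintro s ⟨i, hs⟩ t ⟨j, ht⟩
    rcases eq_or_ne i j with rfl | hij
    · left
      rcases hs with rfl | rfl <;> rcases ht with rfl | rfl <;> simp
    · right
      rcases hs with rfl | rfl <;> rcases ht with rfl | rfl
      exacts [hl i j hij, (hl i j hij).inv_right, (hl i j hij).inv_left,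
        (hl i j hij).inv_left.inv_right]
  have hmem := laplacian_gap_mem hS hS3 (card_symmSet_le x) hSl
  -- Both bounds amount to `3 * 0.238² < 3 - 2√2`, for which any upper bound below 1.41503 would do.
  have hsqrt : √2 < 1.41451 := by
    rw [Real.sqrt_lt' (by norm_num)]; norm_num
  constructor
  · obtain ⟨n, b, hb⟩ := exists_fin_of_mem_sumsOfSquares hmem
    have hgap : IsSpectralGap (symmSet x) (3 - 2 * √2) := ⟨by linarith, n, b, hb⟩
    have hle : ENNReal.ofReal (3 - 2 * √2) ≤ spectralGap (symmSet x) :=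
      le_iSup₂ (f := fun ε (_ : IsSpectralGap (symmSet x) ε) => ENNReal.ofReal ε) _ hgap
    have h1 : ENNReal.ofReal (0.238 ^ 2) ≤ 2 * spectralGap (symmSet x) / 6 := by
      calc ENNReal.ofReal (0.238 ^ 2) ≤ ENNReal.ofReal (2 * (3 - 2 * √2) / 6) :=
            ENNReal.ofReal_le_ofReal (by norm_num at hsqrt ⊢; linarith)
        _ = 2 * ENNReal.ofReal (3 - 2 * √2) / 6 := by
            rw [ENNReal.ofReal_div_of_pos (by norm_num), ENNReal.ofReal_mul (by norm_num)]
            simp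
        _ ≤ _ := by gcongr
    calc ENNReal.ofReal 0.238 = ENNReal.ofReal (0.238 ^ 2) ^ (1 / 2 : ℝ) := by
          rw [ENNReal.ofReal_rpow_of_nonneg (by norm_num) (by norm_num), ← Real.sqrt_eq_rpow,
            Real.sqrt_sq (by norm_num)]
      _ ≤ _ := ENNReal.rpow_le_rpow h1 (by norm_num)
  · refine le_kazhdanConstant hS ?_ (by norm_num) ?_ hmem
    · rw [eq_top_iff, ← hgen]
      refine Subgroup.closure_mono ?_
      rintro _ ⟨i, rfl⟩
      exact mem_symmSet.2 ⟨i, .inl rfl⟩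
    · have hc : ((symmSet x).card : ℝ) ≤ 6 := by exact_mod_cast card_symmSet_le x
      norm_num at hsqrt ⊢
      linarith

lemma closure_range_ronanGen (n : Fin 4) : Subgroup.closure (Set.range (ronanGen n)) = ⊤ :=
  PresentedGroup.closure_range_of _

end ThreeGenerators

-- Ronan's relations, and triples related up to order and inversion.

section RonanRelations

variable {G : Type*} [Group G]

/-- The relation `(ab)² = ba`. -/
def FrobeniusRel (a b : G) : Prop := (a * b) ^ 2 = b * a

/-- Read as an arrow `a → b`, the relation is reversed when both elements are inverted. This
symmetry drives the classification of triples. -/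
lemma FrobeniusRel.inv {a b : G} (h : FrobeniusRel a b) : FrobeniusRel b⁻¹ a⁻¹ := by
  rw [FrobeniusRel, ← mul_inv_rev, ← mul_inv_rev, inv_pow, h]

lemma FrobeniusRel.cubeLinked {a b : G} (h : FrobeniusRel a b) (ha : a ^ 3 = 1) :
    CubeLinked a b :=
  cubeLinked_of_sq_mul_eq ha h

/-- The relations of Ronan's groups for a triple of elements of a group. -/
def SatisfiesRonan (n : Fin 4) (x : Fin 3 → G) : Prop :=
  (∀ i, x i ^ 3 = 1) ∧ FrobeniusRel (x 0) (x 1) ∧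
    ![FrobeniusRel (x 1) (x 2) ∧ FrobeniusRel (x 2) (x 0),
      FrobeniusRel (x 1) (x 2) ∧ FrobeniusRel (x 0) (x 2),
      FrobeniusRel (x 0) (x 2) ∧ FrobeniusRel (x 2)⁻¹ (x 1),
      FrobeniusRel (x 0) (x 2) ∧ FrobeniusRel (x 1) (x 2)⁻¹] n

lemma satisfiesRonan_iff (n : Fin 4) (x : Fin 3 → G) :
    SatisfiesRonan n x ↔ ∀ r ∈ ronanRels n, FreeGroup.lift x r = 1 := by
  fin_cases n <;>
  · simp only [SatisfiesRonan, ronanRels, FrobeniusRel, Fin.forall_fin_succ, Fin.isValue,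
      Fin.zero_eta, Fin.mk_one, Fin.reduceFinMk, Matrix.cons_val, Set.mem_union,
      Set.mem_insert_iff, Set.mem_singleton_iff, or_imp, forall_and, forall_eq, map_mul, map_pow,
      map_inv, FreeGroup.lift_apply_of, mul_inv_eq_one, IsEmpty.forall_iff, and_true, and_assoc,
      Fin.succ_zero_eq_one, Fin.succ_one_eq_two]

end RonanRelations

section RonanTriples

variable {G : Type*} [Group G]

lemma SatisfiesRonan.cubeLinked {n : Fin 4} {x : Fin 3 → G} (h : SatisfiesRonan n x) {i j : Fin 3}
    (hij : i ≠ j) : CubeLinked (x i) (x j) := by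
  obtain ⟨h3, h01, h⟩ := h
  have hc : CubeLinked (x 0) (x 1) ∧ CubeLinked (x 0) (x 2) ∧ CubeLinked (x 1) (x 2) := by
    refine ⟨h01.cubeLinked (h3 0), ?_⟩
    have h3' : (x 2)⁻¹ ^ 3 = 1 := by rw [inv_pow, h3, inv_one]
    fin_cases n
    · exact ⟨(h.2.cubeLinked (h3 2)).symm, h.1.cubeLinked (h3 1)⟩
    · exact ⟨h.2.cubeLinked (h3 0), h.1.cubeLinked (h3 1)⟩
    · exact ⟨h.1.cubeLinked (h3 0), by simpa using (h.2.cubeLinked h3').inv_left.symm⟩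
    · exact ⟨h.1.cubeLinked (h3 0), by simpa using (h.2.cubeLinked (h3 1)).inv_right⟩
  obtain ⟨c01, c02, c12⟩ := hc
  fin_cases i <;> fin_cases j
  exacts [absurd rfl hij, c01, c02, c01.symm, absurd rfl hij, c12, c02.symm, c12.symm,
    absurd rfl hij]

lemma satisfiesRonan_ronanGen (n : Fin 4) : SatisfiesRonan n (ronanGen n) := by
  rw [satisfiesRonan_iff]
  intro r hr
  have : FreeGroup.lift (ronanGen n) = PresentedGroup.mk (ronanRels n) := by
    ext i; simp [ronanGen, PresentedGroup.of]
  rw [this]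
  exact PresentedGroup.one_of_mem hr

/-- With consistent signs the three arrows form a cycle (index 0) or a transitive triangle (index
1). If the third arrow needs an inverse, relabelling and `FrobeniusRel.inv` lead to index 2 or 3. -/
lemma exists_satisfiesRonan_of_rel {a b c : G} (ha : a ^ 3 = 1) (hb : b ^ 3 = 1) (hc : c ^ 3 = 1)
    (hab : FrobeniusRel a b) (hac : FrobeniusRel a c ∨ FrobeniusRel c a)
    (hbc : FrobeniusRel b c ∨ FrobeniusRel c b ∨ FrobeniusRel b⁻¹ c ∨ FrobeniusRel c b⁻¹) :
    ∃ (n : Fin 4) (σ : Equiv.Perm (Fin 3)) (y : Fin 3 → G), SatisfiesRonan n y ∧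
      y (σ 0) ∈ ({a, a⁻¹} : Set G) ∧ y (σ 1) ∈ ({b, b⁻¹} : Set G) ∧
      y (σ 2) ∈ ({c, c⁻¹} : Set G) := by
  have h3 {p q r : G} (hp : p ^ 3 = 1) (hq : q ^ 3 = 1) (hr : r ^ 3 = 1) :
      ∀ i, ![p, q, r] i ^ 3 = 1 := by
    simp [Fin.forall_fin_succ, hp, hq, hr]
  have ha' : a⁻¹ ^ 3 = 1 := by rw [inv_pow, ha, inv_one]
  have hb' : b⁻¹ ^ 3 = 1 := by rw [inv_pow, hb, inv_one]
  rcases hac with hac | hac <;> rcases hbc with hbc | hbc | hbc | hbc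
  · exact ⟨1, 1, ![a, b, c], ⟨h3 ha hb hc, hab, hbc, hac⟩, by simp⟩
  · exact ⟨1, Equiv.swap 1 2, ![a, c, b], ⟨h3 ha hc hb, hac, hbc, hab⟩,
      by simp [Equiv.swap_apply_of_ne_of_ne]⟩
  · exact ⟨2, 1, ![a, b, c], ⟨h3 ha hb hc, hab, hac, by simpa using hbc.inv⟩, by simp⟩
  · exact ⟨3, 1, ![a, b, c], ⟨h3 ha hb hc, hab, hac, by simpa using hbc.inv⟩, by simp⟩
  · exact ⟨0, 1, ![a, b, c], ⟨h3 ha hb hc, hab, hbc, hac⟩, by simp⟩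
  · exact ⟨1, finRotate 3, ![c, a, b], ⟨h3 hc ha hb, hac, hab, hbc⟩, by simp⟩
  · exact ⟨3, Equiv.swap 0 1, ![b⁻¹, a⁻¹, c], ⟨h3 hb' ha' hc, hab.inv, hbc, hac.inv⟩,
      by simp [Equiv.swap_apply_of_ne_of_ne]⟩
  · exact ⟨3, finRotate 3, ![c, a, b⁻¹], ⟨h3 hc ha hb', hac, hbc, by simpa using hab⟩, by simp⟩

/-- Three elements of order three such that any two of them satisfy one of the Frobenius
relations, up to inversion, satisfy Ronan's relations up to order and inversion. -/
theorem exists_satisfiesRonan {x : Fin 3 → G} (h3 : ∀ i, x i ^ 3 = 1)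
    (h : ∀ i j, i ≠ j → ∃ b, (b = x j ∨ b = (x j)⁻¹) ∧
      (FrobeniusRel (x i) b ∨ FrobeniusRel b (x i))) :
    ∃ (n : Fin 4) (σ : Equiv.Perm (Fin 3)) (y : Fin 3 → G), SatisfiesRonan n y ∧
      ∀ i, y (σ i) = x i ∨ y (σ i) = (x i)⁻¹ := by
  have main {a b c : G} (ha : a ^ 3 = 1) (hb : b = x 1 ∨ b = (x 1)⁻¹) (hc : c = x 2 ∨ c = (x 2)⁻¹)
      (ha0 : a = x 0 ∨ a = (x 0)⁻¹)
      (hab : FrobeniusRel a b) (hac : FrobeniusRel a c ∨ FrobeniusRel c a) :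
      ∃ (n : Fin 4) (σ : Equiv.Perm (Fin 3)) (y : Fin 3 → G), SatisfiesRonan n y ∧
        ∀ i, y (σ i) = x i ∨ y (σ i) = (x i)⁻¹ := by
    have hb3 : b ^ 3 = 1 := by rcases hb with rfl | rfl <;> simp [h3]
    have hc3 : c ^ 3 = 1 := by rcases hc with rfl | rfl <;> simp [h3]
    have hbc : FrobeniusRel b c ∨ FrobeniusRel c b ∨ FrobeniusRel b⁻¹ c ∨ FrobeniusRel c b⁻¹ := by
      obtain ⟨d, hd, hr⟩ := h 2 1 (by decide)
      have hd' : d = b ∨ d = b⁻¹ := by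
        rcases hd with rfl | rfl <;> rcases hb with rfl | rfl <;> simp
      have hr' : FrobeniusRel c d ∨ FrobeniusRel d c ∨ FrobeniusRel d⁻¹ c ∨ FrobeniusRel c d⁻¹ := by
        rcases hc with rfl | rfl
        · exact hr.elim .inl (.inr ∘ .inl)
        · exact .inr (.inr (hr.imp .inv .inv))
      rcases hd' with rfl | rfl
      · rcases hr' with h | h | h | h
        exacts [.inr (.inl h), .inl h, .inr (.inr (.inl h)), .inr (.inr (.inr h))]
      · rw [inv_inv] at hr'
        rcases hr' with h | h | h | h
        exacts [.inr (.inr (.inr h)), .inr (.inr (.inl h)), .inl h, .inr (.inl h)]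
    obtain ⟨n, σ, y, hy, h0, h1, h2⟩ := exists_satisfiesRonan_of_rel ha hb3 hc3 hab hac hbc
    refine ⟨n, σ, y, hy, ?_⟩
    have aux {p q r : G} (hp : p ∈ ({q, q⁻¹} : Set G)) (hq : q = r ∨ q = r⁻¹) :
        p = r ∨ p = r⁻¹ := by
      rcases hp with rfl | rfl <;> rcases hq with rfl | rfl <;> simp
    simp only [Fin.forall_fin_succ, Fin.succ_zero_eq_one, Fin.succ_one_eq_two,
      IsEmpty.forall_iff, and_true]
    exact ⟨aux h0 ha0, aux h1 hb, aux h2 hc⟩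
  obtain ⟨b, hb, hab⟩ := h 0 1 (by decide)
  obtain ⟨c, hc, hac⟩ := h 0 2 (by decide)
  have hinv {p q : G} (hp : p = q ∨ p = q⁻¹) : p⁻¹ = q ∨ p⁻¹ = q⁻¹ := by
    rcases hp with rfl | rfl <;> simp
  -- If the arrow points into `x 0`, inverting all three elements makes it point out.
  rcases hab with hab | hab
  · exact main (h3 0) hb hc (.inl rfl) hab hac
  · exact main (by rw [inv_pow, h3, inv_one]) (hinv hb) (hinv hc) (.inr rfl) hab.inv
      (hac.symm.imp .inv .inv)

end RonanTriples

-- Elements of order three in a group of order 21.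

section OrderTwentyOne

variable {H : Type*} [Group H]

/-- In a group of order 21, two elements of order three which generate different subgroups satisfy
one of the Frobenius relations, up to inversion. -/
theorem exists_frobeniusRel_of_card_eq (hH : Nat.card H = 21) {a b : H} (ha : a ^ 3 = 1)
    (hb : b ^ 3 = 1) (ha1 : a ≠ 1) (hb1 : b ≠ 1) (hab : a ≠ b) (hab' : a ≠ b⁻¹) :
    ∃ b', (b' = b ∨ b' = b⁻¹) ∧ (FrobeniusRel a b' ∨ FrobeniusRel b' a) := by
  classical
  have hfin : Finite H := Nat.finite_of_card_ne_zero (by rw [hH]; norm_num)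
  have : Fact (Nat.Prime 7) := ⟨by norm_num⟩
  have : Fact (Nat.Prime 3) := ⟨by norm_num⟩
  obtain ⟨N, hNn, hN, hidx⟩ : ∃ N : Subgroup H, N.Normal ∧ Nat.card N = 7 ∧ N.index = 3 := by
    let P : Sylow 7 H := default
    have hP : Nat.card (P : Subgroup H) = 7 := by
      rw [P.card_eq_multiplicity, hH, show (21 : ℕ) = 7 * 3 by norm_num,
        Nat.factorization_mul (by norm_num) (by norm_num), Finsupp.add_apply,
        Nat.Prime.factorization_self (by norm_num),
        Nat.factorization_eq_zero_of_not_dvd (by norm_num), add_zero, pow_one]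
    have hidx : (P : Subgroup H).index = 3 := by
      have := (P : Subgroup H).card_mul_index
      rw [hH, hP] at this
      omega
    have hsub : Subsingleton (Sylow 7 H) := by
      have h1 := card_sylow_modEq_one 7 H
      have h2 := Nat.le_of_dvd (by norm_num) (hidx ▸ P.card_dvd_index)
      rw [← Finite.card_le_one_iff_subsingleton]
      unfold Nat.ModEq at h1
      omega
    exact ⟨P, P.normal_of_subsingleton, hP, hidx⟩
  have hpow7 : ∀ u ∈ N, u ^ 7 = 1 := fun u hu => by
    simpa [hN] using congr(($(pow_card_eq_one' (x := (⟨u, hu⟩ : N))) : H))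
  have hnot : ∀ u : H, u ^ 3 = 1 → u ∈ N → u = 1 := fun u h3 hu => by
    have h7 := hpow7 u hu
    rwa [show 7 = 3 * 2 + 1 by norm_num, pow_succ, pow_mul, h3, one_pow, one_mul] at h7
  have hQ : Nat.card (H ⧸ N) = 3 := hidx
  have hqa : ((a : H) : H ⧸ N) ≠ 1 := fun h =>
    ha1 (hnot a ha ((QuotientGroup.eq_one_iff a).1 h))
  have hqb : ((b : H) : H ⧸ N) ≠ 1 := fun h =>
    hb1 (hnot b hb ((QuotientGroup.eq_one_iff b).1 h))
  -- In the quotient of order 3 the non-trivial images of `a` and `b` are equal or inverse.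
  obtain ⟨b', hb', hmem⟩ : ∃ b', (b' = b ∨ b' = b⁻¹) ∧ a * b' ∈ N := by
    have hqa3 : (a : H ⧸ N) ^ 3 = 1 := by rw [← QuotientGroup.mk_pow, ha]; rfl
    have hz : (b : H ⧸ N) ∈ Subgroup.zpowers (a : H ⧸ N) := mem_zpowers_of_prime_card hQ hqa
    obtain ⟨k, hk, hkb⟩ := (mem_zpowers_iff_mem_range_orderOf).1 hz |> Finset.mem_image.1
    rw [orderOf_eq_prime hqa3 hqa, Finset.mem_range] at hk
    interval_cases k
    · exact absurd (by simpa using hkb.symm) hqb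
    · refine ⟨b⁻¹, .inr rfl, ?_⟩
      rw [← QuotientGroup.eq_one_iff, QuotientGroup.mk_mul, QuotientGroup.mk_inv, ← hkb]
      simp
    · refine ⟨b, .inl rfl, ?_⟩
      rw [← QuotientGroup.eq_one_iff, QuotientGroup.mk_mul, ← hkb, ← hqa3]
      simp [pow_succ, mul_assoc]
  refine ⟨b', hb', ?_⟩
  have hb'3 : b' ^ 3 = 1 := by rcases hb' with rfl | rfl <;> simp [hb]
  have ht1 : a * b' ≠ 1 := by
    intro h
    rw [mul_eq_one_iff_eq_inv] at h
    rcases hb' with rfl | rfl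
    exacts [hab' h, hab (by simpa using h)]
  set t := a * b' with ht
  have ht7 := hpow7 t hmem
  have hord : orderOf t = 7 := orderOf_eq_prime ht7 ht1
  have hconj : b' * a ∈ Subgroup.zpowers t := by
    have h1 : b' * a ∈ N := by
      have := hNn.conj_mem _ hmem a⁻¹
      rwa [inv_inv, ht, inv_mul_cancel_left] at this
    have h2 : Subgroup.zpowers t = N := by
      apply Subgroup.eq_of_le_of_card_ge (by simpa using hmem)
      rw [Nat.card_zpowers, hord, hN]
    rwa [h2]
  obtain ⟨k, hk, hkt⟩ := (mem_zpowers_iff_mem_range_orderOf).1 hconj |> Finset.mem_image.1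
  rw [hord, Finset.mem_range] at hk
  have hs : SemiconjBy a (t ^ k) t := by
    simp only [SemiconjBy]; rw [hkt, ht, mul_assoc]
  have hs3 : t ^ (k * k * k) = t := by
    have h1 := hs.pow_right k
    have h2 := h1.pow_right k
    have := (hs.mul_left h1).mul_left h2
    rw [← pow_two, ← pow_succ, ha, SemiconjBy, one_mul, mul_one] at this
    rw [pow_mul, pow_mul, this]
  have hmod : k * k * k % 7 = 1 := by
    have h1 : t ^ (k * k * k) = t ^ 1 := by rw [hs3, pow_one]
    rwa [pow_inj_mod, hord] at h1
  -- Here `b'a = a⁻¹ta = tᵏ` and `k³ ≡ 1` modulo 7. For `k = 1` the elements commute and `t³ = 1`,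
  -- which is impossible; `k = 2` is `(ab')² = b'a`; for `k = 4`, `(b'a)² = t⁸ = ab'`.
  have hk' : k = 1 ∨ k = 2 ∨ k = 4 := by
    interval_cases k <;> simp_all
  rcases hk' with rfl | rfl | rfl
  · have hcomm : Commute a b' := by rw [Commute, SemiconjBy, ← hkt, pow_one]
    exact absurd (hnot t (by rw [ht, hcomm.mul_pow, ha, hb'3, one_mul]) hmem) ht1
  · exact .inl hkt
  · right
    rw [FrobeniusRel, ← hkt, ← pow_mul, show 4 * 2 = 7 + 1 by norm_num, pow_succ, ht7, one_mul]

end OrderTwentyOne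

-- Counting in the Fano plane.

section Fano

/-- Over the field with two elements, points are non-zero vectors. -/
def fanoPointEquiv : {v : Fin 3 → ZMod 2 // v ≠ 0} ≃ ℙ (ZMod 2) (Fin 3 → ZMod 2) :=
  Equiv.ofBijective (fun v => Projectivization.mk (ZMod 2) v.1 v.2) <| by
    constructor
    · rintro ⟨v, hv⟩ ⟨w, hw⟩ h
      obtain ⟨a, ha⟩ := (Projectivization.mk_eq_mk_iff _ _ _ hv hw).1 h
      rw [Subsingleton.elim a 1, one_smul] at ha
      exact Subtype.ext ha.symm
    · intro p
      induction p with | h v hv => exact ⟨⟨v, hv⟩, rfl⟩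

lemma card_fanoPoint : Nat.card (ℙ (ZMod 2) (Fin 3 → ZMod 2)) = 7 := by
  rw [← Nat.card_congr fanoPointEquiv, Nat.card_eq_fintype_card]
  decide

lemma card_orthogonal (p : ℙ (ZMod 2) (Fin 3 → ZMod 2)) :
    Nat.card {q // p.orthogonal q} = 3 := by
  obtain ⟨⟨v, hv⟩, rfl⟩ := fanoPointEquiv.surjective p
  have e : {w : {w : Fin 3 → ZMod 2 // w ≠ 0} // v ⬝ᵥ w.1 = 0} ≃
      {q // (fanoPointEquiv ⟨v, hv⟩).orthogonal q} :=
    fanoPointEquiv.subtypeEquiv fun w => (Projectivization.orthogonal_mk hv w.2).symm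
  rw [← Nat.card_congr e, Nat.card_eq_fintype_card]
  clear e
  revert v
  decide

instance : Finite (ℙ (ZMod 2) (Fin 3 → ZMod 2)) := Finite.of_equiv _ fanoPointEquiv

lemma card_neighborSet_fanoGraph
    (x : ℙ (ZMod 2) (Fin 3 → ZMod 2) ⊕ ℙ (ZMod 2) (Fin 3 → ZMod 2)) :
    Nat.card (fanoGraph.neighborSet x) = 3 := by
  rcases x with p | p <;> refine Eq.trans ?_ (card_orthogonal p)
  · refine (Nat.card_congr (Equiv.ofBijective (fun q => ⟨.inr q.1, q.2⟩) ⟨?_, ?_⟩)).symm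
    · intro q r h; simpa [Subtype.ext_iff] using h
    · rintro ⟨q | q, hq⟩
      exacts [hq.elim, ⟨⟨q, hq⟩, rfl⟩]
  · refine (Nat.card_congr (Equiv.ofBijective
      (fun q => ⟨.inl q.1, Projectivization.orthogonal_comm.1 q.2⟩) ⟨?_, ?_⟩)).symm
    · intro q r h; simpa [Subtype.ext_iff] using h
    · rintro ⟨q | q, hq⟩
      exacts [⟨⟨q, Projectivization.orthogonal_comm.1 hq⟩, rfl⟩, hq.elim]

lemma card_incidenceSet_fanoGraph
    (x : ℙ (ZMod 2) (Fin 3 → ZMod 2) ⊕ ℙ (ZMod 2) (Fin 3 → ZMod 2)) :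
    Nat.card (fanoGraph.incidenceSet x) = 3 := by
  classical
  rw [Nat.card_congr (fanoGraph.incidenceSetEquivNeighborSet x), card_neighborSet_fanoGraph]

lemma card_edgeSet_fanoGraph : Nat.card fanoGraph.edgeSet = 21 := by
  classical
  have : Fintype (ℙ (ZMod 2) (Fin 3 → ZMod 2)) := Fintype.ofFinite _
  have h := fanoGraph.sum_degrees_eq_twice_card_edges
  have hd : ∀ x, fanoGraph.degree x = 3 := fun x => by
    rw [← SimpleGraph.card_neighborSet_eq_degree, ← Nat.card_eq_fintype_card,
      card_neighborSet_fanoGraph]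
  simp only [hd, Finset.sum_const, Finset.card_univ, smul_eq_mul, ← Nat.card_eq_fintype_card,
    Nat.card_sum, card_fanoPoint] at h
  rw [Nat.card_eq_fintype_card, ← SimpleGraph.edgeFinset_card]
  omega

end Fano

-- Local structure of a triangle geometry.

namespace TriangleComplex

variable {V : Type*} {E : Type*} {T : Type*} {X : TriangleComplex V E T}

lemma side_mem_iff {v : V} {t : T} {i : Fin 3} :
    v ∈ X.ends (X.side t i) ↔ v = X.corner t (i + 1) ∨ v = X.corner t (i + 2) := by
  rw [X.ends_side, Sym2.mem_iff]

lemma vtype_of_mem_side {v : V} {t : T} {i : Fin 3} (h : v ∈ X.ends (X.side t i)) :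
    X.vtype v ≠ i ∧ X.corner t (X.vtype v) = v := by
  rcases side_mem_iff.1 h with rfl | rfl <;> rw [X.vtype_corner] <;> simp

/-- A side determines its type. -/
lemma side_type_unique {t t' : T} {i j : Fin 3} (h : X.side t i = X.side t' j) : i = j := by
  have h1 := (vtype_of_mem_side (X := X) (v := X.corner t' (j + 1)) (t := t) (i := i)
    (by rw [h, side_mem_iff]; exact .inl rfl)).1
  have h2 := (vtype_of_mem_side (X := X) (v := X.corner t' (j + 2)) (t := t) (i := i)
    (by rw [h, side_mem_iff]; exact .inr rfl)).1
  rw [X.vtype_corner] at h1 h2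
  clear h
  revert i j; decide

lemma corner_mem_side (t : T) {i j : Fin 3} (h : i ≠ j) : X.corner t i ∈ X.ends (X.side t j) := by
  rw [side_mem_iff]
  have : i = j + 1 ∨ i = j + 2 := by revert i j; decide
  exact this.imp (congrArg _) (congrArg _)

/-- There are 21 triangles at a vertex. -/
lemma LinkIsFano.card_triangles {v : V} (h : X.LinkIsFano v) :
    Nat.card {t | X.corner t (X.vtype v) = v} = 21 := by
  obtain ⟨φ, -, hT⟩ := h
  rw [← card_edgeSet_fanoGraph]
  exact Nat.card_congr (hT.equiv _)

/-- An edge at a vertex of type `j` is a side of type `j + 1` or `j + 2`, of three triangles. -/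
lemma LinkIsFano.card_triangles_edge {v : V} (h : X.LinkIsFano v) {e : E} (he : v ∈ X.ends e) :
    Nat.card {t | X.corner t (X.vtype v) = v ∧
      (X.side t (X.vtype v + 1) = e ∨ X.side t (X.vtype v + 2) = e)} = 3 := by
  obtain ⟨φ, hE, hT⟩ := h
  refine Eq.trans ?_ (card_incidenceSet_fanoGraph (φ e))
  refine Nat.card_congr (Set.BijOn.equiv (fun t =>
    s(φ (X.side t (X.vtype v + 1)), φ (X.side t (X.vtype v + 2)))) ?_)
  -- `φ` is injective only on the edges at `v`, so the compared side must be shown to pass through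
  -- `v`.
  have hside : ∀ t, X.corner t (X.vtype v) = v → ∀ k : Fin 3, k ≠ 0 →
      (φ e = φ (X.side t (X.vtype v + k)) ↔ X.side t (X.vtype v + k) = e) := by
    intro t ht k hk
    refine ⟨fun h => (hE.injOn he ?_ h).symm, fun h => h ▸ rfl⟩
    have := corner_mem_side (X := X) t (i := X.vtype v) (j := X.vtype v + k) (by simpa using hk)
    rwa [ht] at this
  have hmem : ∀ t, X.corner t (X.vtype v) = v →
      (φ e ∈ s(φ (X.side t (X.vtype v + 1)), φ (X.side t (X.vtype v + 2))) ↔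
        (X.side t (X.vtype v + 1) = e ∨ X.side t (X.vtype v + 2) = e)) := by
    intro t ht
    rw [Sym2.mem_iff, hside t ht 1 (by decide), hside t ht 2 (by decide)]
  refine ⟨fun t ht => ⟨hT.mapsTo ht.1, (hmem t ht.1).2 ht.2⟩, hT.injOn.mono fun t ht => ht.1, ?_⟩
  rintro s ⟨hs, hes⟩
  obtain ⟨t, ht, rfl⟩ := hT.surjOn hs
  exact ⟨t, ⟨ht, (hmem t ht).1 hes⟩, rfl⟩

lemma LinkIsFano.triangle_ext {v : V} (h : X.LinkIsFano v) {t t' : T}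
    (ht : X.corner t (X.vtype v) = v) (ht' : X.corner t' (X.vtype v) = v)
    (h1 : X.side t (X.vtype v + 1) = X.side t' (X.vtype v + 1))
    (h2 : X.side t (X.vtype v + 2) = X.side t' (X.vtype v + 2)) : t = t' := by
  obtain ⟨φ, -, hT⟩ := h
  exact hT.injOn ht ht' (by simp only [h1, h2])

end TriangleComplex

-- Stabilizers and natural generators of a regular action.

namespace TriangleComplex

lemma AreNaturalGenerators.mem_stabilizer {V E T : Type*} {X : TriangleComplex V E T}
    {G : Type*} [Group G] [MulAction G E] {t : T} {x : Fin 3 → G}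
    (h : X.AreNaturalGenerators t x) (i : Fin 3) : x i ∈ MulAction.stabilizer G (X.side t i) :=
  h i ▸ Subgroup.mem_zpowers (x i)

variable {V E T : Type*} {X : TriangleComplex V E T} {G : Type*} [Group G] [MulAction G V]
  [MulAction G E] [MulAction G T]

/-- Regularity makes `g ↦ g • t` a bijection from `G` to the triangles, so orders of stabilizers are
counts of triangles. -/
lemma card_subgroup_of_regular (hreg : ∀ t t' : T, ∃! g : G, g • t = t') (t : T)
    {K : Subgroup G} {s : Set T} (h : ∀ g, g ∈ K ↔ g • t ∈ s) : Nat.card K = Nat.card s := by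
  refine Nat.card_congr (Equiv.ofBijective (fun g => ⟨g.1 • t, (h g).1 g.2⟩) ⟨?_, ?_⟩)
  · intro g g' hg
    exact Subtype.ext ((hreg t (g'.1 • t)).unique (congrArg Subtype.val hg) rfl)
  · rintro ⟨t', ht'⟩
    obtain ⟨g, rfl, -⟩ := hreg t t'
    exact ⟨⟨g, (h g).2 ht'⟩, rfl⟩

lemma mem_stabilizer_corner (hA : X.ActsByAutomorphisms G) {t : T} {i : Fin 3} {g : G} :
    g ∈ MulAction.stabilizer G (X.corner t i) ↔ X.corner (g • t) i = X.corner t i := by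
  rw [MulAction.mem_stabilizer_iff, hA.corner_smul]

lemma mem_stabilizer_side (hA : X.ActsByAutomorphisms G) {t : T} {i : Fin 3} {g : G} :
    g ∈ MulAction.stabilizer G (X.side t i) ↔ X.side (g • t) i = X.side t i := by
  rw [MulAction.mem_stabilizer_iff, hA.side_smul]

lemma card_stabilizer_corner (hX : ∀ v, X.LinkIsFano v) (hA : X.ActsByAutomorphisms G)
    (hreg : ∀ t t' : T, ∃! g : G, g • t = t') (t : T) (i : Fin 3) :
    Nat.card (MulAction.stabilizer G (X.corner t i)) = 21 := by
  rw [← (hX (X.corner t i)).card_triangles]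
  refine card_subgroup_of_regular hreg t fun g => ?_
  rw [mem_stabilizer_corner hA, Set.mem_ofPred_eq, X.vtype_corner]

lemma card_stabilizer_side (hX : ∀ v, X.LinkIsFano v) (hA : X.ActsByAutomorphisms G)
    (hreg : ∀ t t' : T, ∃! g : G, g • t = t') (t : T) (i : Fin 3) :
    Nat.card (MulAction.stabilizer G (X.side t i)) = 3 := by
  have hv : X.corner t (i + 1) ∈ X.ends (X.side t i) := side_mem_iff.2 (.inl rfl)
  refine Eq.trans ?_ ((hX (X.corner t (i + 1))).card_triangles_edge hv)
  refine card_subgroup_of_regular hreg t fun g => ?_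
  -- Seen from the corner of type `i + 1`, the side of type `i` is the second of the two sides; the
  -- first is ruled out by its type.
  have h2 : i + 1 + 2 = i := by rw [add_assoc]; exact add_zero i
  rw [mem_stabilizer_side hA, Set.mem_ofPred_eq, X.vtype_corner, h2]
  constructor
  · intro h
    rw [← h] at hv
    have := (vtype_of_mem_side hv).2
    rw [X.vtype_corner] at this
    exact ⟨this, .inr h⟩
  · rintro ⟨-, h | h⟩
    · exact absurd (side_type_unique h) (by simp [add_assoc])
    · exact h

lemma stabilizer_side_le (hA : X.ActsByAutomorphisms G) (t : T) {i j : Fin 3} (hij : i ≠ j) :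
    MulAction.stabilizer G (X.side t i) ≤ MulAction.stabilizer G (X.corner t j) := by
  intro g hg
  rw [mem_stabilizer_side hA] at hg
  rw [mem_stabilizer_corner hA]
  have hv := corner_mem_side (X := X) t hij.symm
  rw [← hg] at hv
  have := (vtype_of_mem_side hv).2
  rwa [X.vtype_corner] at this

lemma exists_third {i j : Fin 3} (hij : i ≠ j) :
    ∃ k, i ≠ k ∧ j ≠ k ∧ ((i = k + 1 ∧ j = k + 2) ∨ (j = k + 1 ∧ i = k + 2)) := by
  revert i j; decide

/-- The link is a simple graph, so two sides through a common corner determine the triangle; an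
element fixing both fixes `t`. -/
lemma eq_one_of_mem_stabilizer_sides (hX : ∀ v, X.LinkIsFano v) (hA : X.ActsByAutomorphisms G)
    (hreg : ∀ t t' : T, ∃! g : G, g • t = t') {t : T} {i j : Fin 3} (hij : i ≠ j) {g : G}
    (hi : g ∈ MulAction.stabilizer G (X.side t i))
    (hj : g ∈ MulAction.stabilizer G (X.side t j)) : g = 1 := by
  obtain ⟨k, hik, hjk, h⟩ := exists_third hij
  have hk := stabilizer_side_le hA t hik hi
  rw [mem_stabilizer_side hA] at hi hj
  rw [mem_stabilizer_corner hA] at hk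
  have hgt : g • t = t := by
    refine (hX (X.corner t k)).triangle_ext ?_ ?_ ?_ ?_ <;> rw [X.vtype_corner]
    · exact hk
    · rcases h with ⟨rfl, rfl⟩ | ⟨rfl, rfl⟩ <;> assumption
    · rcases h with ⟨rfl, rfl⟩ | ⟨rfl, rfl⟩ <;> assumption
  exact (hreg t t).unique hgt (one_smul G t)

lemma exists_areNaturalGenerators (hX : ∀ v, X.LinkIsFano v) (hA : X.ActsByAutomorphisms G)
    (hreg : ∀ t t' : T, ∃! g : G, g • t = t') (t : T) :
    ∃ x : Fin 3 → G, X.AreNaturalGenerators t x := by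
  have h (i : Fin 3) : ∃ g, Subgroup.zpowers g = MulAction.stabilizer G (X.side t i) := by
    have : Fact (Nat.Prime 3) := ⟨by norm_num⟩
    exact (Subgroup.isCyclic_iff_exists_zpowers_eq_top _).1
      (isCyclic_of_prime_card (card_stabilizer_side hX hA hreg t i))
  choose x hx using h
  exact ⟨x, hx⟩

namespace AreNaturalGenerators

variable {t : T} {x : Fin 3 → G}

lemma orderOf_eq (h : X.AreNaturalGenerators t x) (hX : ∀ v, X.LinkIsFano v)
    (hA : X.ActsByAutomorphisms G) (hreg : ∀ t t' : T, ∃! g : G, g • t = t') (i : Fin 3) :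
    orderOf (x i) = 3 := by
  rw [← Nat.card_zpowers, h i, card_stabilizer_side hX hA hreg]

lemma ne_one (h : X.AreNaturalGenerators t x) (hX : ∀ v, X.LinkIsFano v)
    (hA : X.ActsByAutomorphisms G) (hreg : ∀ t t' : T, ∃! g : G, g • t = t') (i : Fin 3) :
    x i ≠ 1 := by
  intro h1
  have := h.orderOf_eq hX hA hreg i
  rw [h1, orderOf_one] at this
  omega

lemma pow_three (h : X.AreNaturalGenerators t x) (hX : ∀ v, X.LinkIsFano v)
    (hA : X.ActsByAutomorphisms G) (hreg : ∀ t t' : T, ∃! g : G, g • t = t') (i : Fin 3) :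
    x i ^ 3 = 1 := by
  rw [← h.orderOf_eq hX hA hreg i, pow_orderOf_eq_one]

lemma notMem_stabilizer (h : X.AreNaturalGenerators t x) (hX : ∀ v, X.LinkIsFano v)
    (hA : X.ActsByAutomorphisms G) (hreg : ∀ t t' : T, ∃! g : G, g • t = t') {i j : Fin 3}
    (hij : i ≠ j) : x i ∉ MulAction.stabilizer G (X.side t j) := fun hj =>
  h.ne_one hX hA hreg i
    (eq_one_of_mem_stabilizer_sides hX hA hreg hij (h.mem_stabilizer i) hj)

lemma exists_frobeniusRel (h : X.AreNaturalGenerators t x) (hX : ∀ v, X.LinkIsFano v)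
    (hA : X.ActsByAutomorphisms G) (hreg : ∀ t t' : T, ∃! g : G, g • t = t') {i j : Fin 3}
    (hij : i ≠ j) :
    ∃ b, (b = x j ∨ b = (x j)⁻¹) ∧ (FrobeniusRel (x i) b ∨ FrobeniusRel b (x i)) := by
  obtain ⟨k, hik, hjk, -⟩ := exists_third hij
  have hnot := h.notMem_stabilizer hX hA hreg hij
  obtain ⟨b, hb, hr⟩ := exists_frobeniusRel_of_card_eq (card_stabilizer_corner hX hA hreg t k)
    (a := ⟨x i, stabilizer_side_le hA t hik (h.mem_stabilizer i)⟩)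
    (b := ⟨x j, stabilizer_side_le hA t hjk (h.mem_stabilizer j)⟩)
    (Subtype.ext (h.pow_three hX hA hreg i)) (Subtype.ext (h.pow_three hX hA hreg j))
    (fun h1 => h.ne_one hX hA hreg i (congrArg Subtype.val h1))
    (fun h1 => h.ne_one hX hA hreg j (congrArg Subtype.val h1))
    (fun h1 => hnot <| by
      rw [show x i = x j from congrArg Subtype.val h1]; exact h.mem_stabilizer j)
    (fun h1 => hnot <| by
      rw [show x i = (x j)⁻¹ from congrArg Subtype.val h1]
      exact inv_mem (h.mem_stabilizer j))
  exact ⟨b, hb.imp (congrArg Subtype.val) (congrArg Subtype.val),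
    hr.imp (congrArg Subtype.val) (congrArg Subtype.val)⟩

/-- The intersection with `K` contains two different subgroups of order 3, so its order is a divisor
of 21 that is a multiple of 3 other than 3. -/
lemma stabilizer_corner_le (h : X.AreNaturalGenerators t x) (hX : ∀ v, X.LinkIsFano v)
    (hA : X.ActsByAutomorphisms G) (hreg : ∀ t t' : T, ∃! g : G, g • t = t') {K : Subgroup G}
    (hK : ∀ i, x i ∈ K) (k : Fin 3) : MulAction.stabilizer G (X.corner t k) ≤ K := by
  set H := MulAction.stabilizer G (X.corner t k) with hH
  have hcard : Nat.card H = 21 := card_stabilizer_corner hX hA hreg t k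
  have hle (i : Fin 3) (hik : i ≠ k) : MulAction.stabilizer G (X.side t i) ≤ K ⊓ H :=
    le_inf (by rw [← h i, Subgroup.zpowers_le]; exact hK i) (stabilizer_side_le hA t hik)
  have hfin : Finite H := Nat.finite_of_card_ne_zero (by rw [hcard]; norm_num)
  have hfin' : Finite (K ⊓ H : Subgroup G) :=
    Finite.of_injective _ (Subgroup.inclusion_injective inf_le_right)
  have hd1 : Nat.card (K ⊓ H : Subgroup G) ∣ 21 := hcard ▸ Subgroup.card_dvd_of_le inf_le_right
  have hk1 : k + 1 ≠ k := by simp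
  have hk2 : k + 2 ≠ k := by simp
  have hd2 : 3 ∣ Nat.card (K ⊓ H : Subgroup G) := by
    rw [← card_stabilizer_side hX hA hreg t (k + 1)]
    exact Subgroup.card_dvd_of_le (hle _ hk1)
  have hne : Nat.card (K ⊓ H : Subgroup G) ≠ 3 := by
    intro h3
    have heq : MulAction.stabilizer G (X.side t (k + 1)) = K ⊓ H :=
      Subgroup.eq_of_le_of_card_ge (hle _ hk1) (by rw [h3, card_stabilizer_side hX hA hreg])
    have h12 : k + 2 ≠ k + 1 := by simp
    exact h.notMem_stabilizer hX hA hreg h12 (heq ▸ hle _ hk2 (h.mem_stabilizer _))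
  have h21 : Nat.card (K ⊓ H : Subgroup G) = 21 := by
    obtain ⟨m, hm⟩ := hd2
    rw [hm] at hd1 hne ⊢
    have h7 : m ∣ 7 := Nat.dvd_of_mul_dvd_mul_left (by norm_num) (show 3 * m ∣ 3 * 7 from hd1)
    rcases (Nat.dvd_prime (by norm_num)).1 h7 with rfl | rfl
    · exact absurd rfl hne
    · rfl
  have : K ⊓ H = H := Subgroup.eq_of_le_of_card_ge inf_le_right (by rw [hcard, h21])
  exact inf_eq_right.1 this

/-- Natural generators generate the group. -/
theorem closure_range_eq_top (h : X.AreNaturalGenerators t x) (hX : X.IsTrivalentGeometry)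
    (hA : X.ActsByAutomorphisms G) (hreg : ∀ t t' : T, ∃! g : G, g • t = t') :
    Subgroup.closure (Set.range x) = ⊤ := by
  set K := Subgroup.closure (Set.range x) with hKdef
  have hK : ∀ i, x i ∈ K := fun i => Subgroup.subset_closure ⟨i, rfl⟩
  have hst := h.stabilizer_corner_le hX.2 hA hreg hK
  have hmem {g k : G} {i : Fin 3} (hk : k ∈ K) (hg : g • X.corner t i = k • X.corner t i) :
      g ∈ K := by
    have h1 : k⁻¹ * g ∈ K := hst i (by
      rw [MulAction.mem_stabilizer_iff, mul_smul, hg, inv_smul_smul])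
    simpa using mul_mem hk h1
  -- Induction along a path: an edge from `v = k • corner` to `w` lies in some triangle `g • t`. As
  -- `g` and `k` carry the same corner of `t` to `v`, `hmem` puts `g` in `K`, and `g` carries a
  -- corner of `t` to `w`.
  have horbit : ∀ v, ∃ k ∈ K, v = k • X.corner t (X.vtype v) := by
    intro v
    have hr : X.oneSkeleton.Reachable (X.corner t 0) v := hX.1.preconnected _ _
    rw [SimpleGraph.reachable_iff_reflTransGen] at hr
    induction hr with
    | refl => exact ⟨1, one_mem _, by rw [one_smul, X.vtype_corner]⟩
    | @tail v w _ hvw ih =>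
      obtain ⟨k, hk, hv⟩ := ih
      obtain ⟨e, he⟩ : ∃ e, X.ends e = s(v, w) := by
        obtain ⟨-, ⟨e, he⟩ | ⟨e, he⟩⟩ := (SimpleGraph.fromRel_adj _ _ _).1 hvw
        exacts [⟨e, he⟩, ⟨e, he.trans Sym2.eq_swap⟩]
      have hcard := (hX.2 v).card_triangles_edge (e := e) (by simp [he])
      obtain ⟨⟨t', ht', hside⟩⟩ := (Nat.card_pos_iff.1 (by rw [hcard]; norm_num)).1
      obtain ⟨g, rfl, -⟩ := hreg t t'
      have hw : X.corner (g • t) (X.vtype w) = w := by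
        rcases hside with rfl | rfl <;>
        exact (vtype_of_mem_side (by rw [he]; exact Sym2.mem_mk_right v w)).2
      rw [hA.corner_smul] at ht' hw
      exact ⟨g, hmem hk (ht'.trans hv), hw.symm⟩
  rw [eq_top_iff]
  intro g _
  obtain ⟨k, hk, hg⟩ := horbit (g • X.corner t 0)
  rw [hA.vtype_smul, X.vtype_corner] at hg
  exact hmem hk hg

end AreNaturalGenerators

end TriangleComplex

end

-- The theorem.

theorem mainTheorem3 :
    -- Ronan's groups
    (∀ n : Fin 4,
      ENNReal.ofReal 0.238 ≤ (2 * spectralGap (symmSet (ronanGen n)) / 6) ^ (1 / 2 : ℝ) ∧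
      ENNReal.ofReal 0.238 ≤ kazhdanConstant.{w} (symmSet (ronanGen n))) ∧
    -- groups acting regularly on the triangles of a trivalent triangle geometry
    (∀ (V : Type u₁) (E : Type u₂) (T : Type u₃) (X : TriangleComplex V E T) (G : Type u₄)
      [Group G] [MulAction G V] [MulAction G E] [MulAction G T],
      X.IsTrivalentGeometry → X.ActsByAutomorphisms G → (∀ t t' : T, ∃! g : G, g • t = t') →
      ∀ t : T,
        (∃ x : Fin 3 → G, X.AreNaturalGenerators t x) ∧
        (∃ (n : Fin 4) (f : RonanGroup n →* G) (σ : Equiv.Perm (Fin 3)),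
          Function.Surjective f ∧ X.AreNaturalGenerators t (fun i => f (ronanGen n (σ i)))) ∧
        ∀ x : Fin 3 → G, X.AreNaturalGenerators t x →
          Subgroup.closure (Set.range x) = ⊤ ∧
          ENNReal.ofReal 0.238 ≤ (2 * spectralGap (symmSet x) / 6) ^ (1 / 2 : ℝ) ∧
          ENNReal.ofReal 0.238 ≤ kazhdanConstant.{w} (symmSet x)) := by
  constructor
  · intro n
    exact spectral_bounds_of_cubeLinked (satisfiesRonan_ronanGen n).1
      (fun i j hij => (satisfiesRonan_ronanGen n).cubeLinked hij) (closure_range_ronanGen n)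
  · intro V E T X G _ _ _ _ hX hA hreg t
    refine ⟨TriangleComplex.exists_areNaturalGenerators hX.2 hA hreg t, ?_, ?_⟩
    · obtain ⟨x, hx⟩ := TriangleComplex.exists_areNaturalGenerators hX.2 hA hreg t
      obtain ⟨n, σ, y, hy, hxy⟩ := exists_satisfiesRonan (hx.pow_three hX.2 hA hreg)
        fun i j hij => hx.exists_frobeniusRel hX.2 hA hreg hij
      let f : RonanGroup n →* G := PresentedGroup.toGroup ((satisfiesRonan_iff n y).1 hy)
      have hf : ∀ i, f (ronanGen n i) = y i := fun i => PresentedGroup.toGroup.of _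
      have hnat : X.AreNaturalGenerators t (fun i => f (ronanGen n (σ i))) := by
        intro i
        rw [← hx i]
        simp only [hf]
        rcases hxy i with h | h <;> rw [h]
        exact Subgroup.zpowers_inv
      refine ⟨n, f, σ, ?_, hnat⟩
      rw [← MonoidHom.range_eq_top, eq_top_iff, ← hnat.closure_range_eq_top hX hA hreg,
        Subgroup.closure_le]
      rintro _ ⟨i, rfl⟩
      exact ⟨_, rfl⟩
    · intro x hx
      have hgen := hx.closure_range_eq_top hX hA hreg
      refine ⟨hgen, spectral_bounds_of_cubeLinked (hx.pow_three hX.2 hA hreg) ?_ hgen⟩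
      intro i j hij
      obtain ⟨b, hb, hr⟩ := hx.exists_frobeniusRel hX.2 hA hreg hij
      have h3 := hx.pow_three hX.2 hA hreg
      have hl : CubeLinked (x i) b := by
        rcases hr with hr | hr
        · exact hr.cubeLinked (h3 i)
        · exact (hr.cubeLinked (by rcases hb with rfl | rfl <;> simp [h3])).symm
      rcases hb with rfl | rfl
      · exact hl
      · simpa using hl.inv_right
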